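/- **Setting.** Consider the planar rotated surface code of distance $d$: data qubits sit at the points of $[0,2d]^2$ with both coordinates odd; stabilizer ancillas sit at points with both coordinates even, their type ($X$ or $Z$) alternating in a checkerboard pattern (either colouring), with all faces in the interior of the square, only $Z$-type (weight-two) faces on the left and right sides and only $X$-type (weight-two) faces on the bottom and top sides; thus a horizontal row of $Z$'s is a logical $Z$. An ancilla at $(x,y)$ acts on the existing data qubits among NW $(x-1,y+1)$, NE $(x+1,y+1)$, SW $(x-1,y-1)$, SE $(x+1,y-1)$. *Mid-SWAP syndrome extraction.* In each round: (0) a fresh atom is loaded at every ancilla site, in $|0\rangle$ ($Z$ type) or $|+\rangle$ ($X$ type); (1) first CNOT of every ancilla; (2) every ancilla atom is exchanged (shuttled, together with its quantum state) with the data atom of its first CNOT, i.e. with the atom at NW, if that site exists; (3)–(5) second, third and fourth CNOT; (6) all ancilla sites are read out destructively, in the $Z$ basis ($Z$ type) or the $X$ basis ($X$ type), by a measurement that also reports whether the atom is missing. A $Z$ ancilla is the target of its CNOTs and visits its data qubits in the order NW, SW, NE, SE; an $X$ ancilla is the control and visits them in the order NW, NE, SW, SE; non-existing data qubits are skipped.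 Run $R\ge 2$ rounds, starting from any state that is a joint eigenvector of the $X$ stabilizers with known eigenvalues $(-1)^{g_u}$. *Detectors and matching graph.* The $X$-detector at $u$ in round $c$ is the sum modulo $2$ of the results of $X$ ancilla $u$ in rounds $c-1$ and $c$ (for $c=0$, of $g_u$ and the result in round $0$). The projection of a set of triggered detectors to the plane is the set of points above which an odd number of detectors is triggered. Two points are joined in the (projected) matching graph if some single-qubit Pauli error at one space-time location of the loss-free circuit triggers exactly one $X$-detector above each of them and no other $X$-detector. *Atom loss.* After an atom is lost (between any two of the steps above), all later CNOTs on it are removed until its site is reloaded, shuttling moves the vacancy, and the result bit of its readout is arbitrary. The *Pauli envelope* of a single loss is the set of all products of arbitrary single-qubit Pauli operators at: the loss location; the location of the lost atom just before each later CNOT in which its role (control/target) differs from its role in its preceding CNOT after the loss; and its location just before its readout. A detector pattern *can be caused by the loss* if it occurs with positive probability either in the circuit with the gates of the lost atom removed, or in the loss-free circuit with some Pauli error from the envelope. **Claim.** Suppose exactly one atom is lost and the loss is detected at the readout of an ancilla in some round that is not the last. 1. If the loss is detected at a $Z$-stabilizer ancilla at $(x,y)$, then for each detector pattern of $X$-detectors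 ($Z$-error detectors) that can be caused by the loss there is one pair $S$ among $$S_1=\{(x-2,y),(x,y+2)\},\quad S_2=\{(x,y+2),(x,y-2)\},\quad S_3=\{(x,y-2),(x+2,y)\}$$ such that all triggered $X$-detectors lie above points of $S$ and the projection of the pattern to the plane is either empty or $S$. Moreover $S_1,S_2,S_3$ are edges of the matching graph, and they form a $Z$-shaped path $(x-2,y)\to(x,y+2)\to(x,y-2)\to(x+2,y)$ in it. 2. If the loss is detected at an $X$-stabilizer ancilla at $(x,y-2)$, then for each detector pattern of $X$-detectors that can be caused by the loss, all triggered $X$-detectors lie above points of $S_4=\{(x-2,y),(x,y-2)\}$ and the projection of the pattern to the plane is either empty or $S_4$; moreover $S_4$ is an edge of the matching graph. Near the boundary of the code, points of $S_1,\dots,S_4$ that carry no $X$ stabilizer are disregarded: "$S$" in "empty or $S$" is then the set of those of its points that carry one, the edge claims are made for pairs both of whose points carry $X$ stabilizers, and the path claim when all four points do. -/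

import Mathlib

namespace MidSwap

/-! ### Circuits with atom loss on a register of sites -/

section Circuits

variable {Q : Type} [DecidableEq Q]

/-- Operations on a register of sites. `swap` is the shuttling of two atoms, which exchanges
their sites together with the quantum states they carry. `prepZ`, `prepX` load a fresh atom in
`|0⟩`, `|+⟩`. -/
inductive Gate (Q : Type) where
  | prepZ (q : Q)
  | prepX (q : Q)
  | cnot (control target : Q)
  | swap (u v : Q)
  | measZ (q : Q)
  | measX (q : Q)

/-- A circuit is a sequence of moments; the gates of one moment are executed in parallel. -/
abbrev Circuit (Q : Type) := ℕ → List (Gate Q)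

/-- Amplitudes in the computational basis (not necessarily normalized). -/
abbrev State (Q : Type) := (Q → ZMod 2) → ℂ

/-- The single-qubit Pauli operator `X ^ x * Z ^ z`, up to phase, is the pair `(x, z)`; the
composition of Pauli operators is addition. -/
abbrev Pauli := ZMod 2 × ZMod 2

/-- A Pauli error configuration: `p n q` acts on site `q` just before moment `n`. -/
abbrev PauliConfig (Q : Type) := ℕ → Q → Pauli

/-- A loss configuration: `l n q` says that the atom at site `q` is lost just before
moment `n`. -/
abbrev LossConfig (Q : Type) := ℕ → Q → Bool

/-- A bit for every space-time location; a measurement record gives the result of measuring `q`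
in moment `n` (entries where nothing is measured are immaterial). -/
abbrev Record (Q : Type) := ℕ → Q → ZMod 2

def noPauli : PauliConfig Q := fun _ _ => 0

def noLoss : LossConfig Q := fun _ _ => false

def singleLoss (n₀ : ℕ) (q₀ : Q) : LossConfig Q := fun n q => decide (n = n₀ ∧ q = q₀)

/-- How one gate changes the set of sites whose atom is missing. -/
def gateLost (f : Q → Bool) : Gate Q → Q → Bool
  | .prepZ q => Function.update f q false
  | .prepX q => Function.update f q false
  | .swap u v => f ∘ Equiv.swap u v
  | .cnot _ _ => f
  | .measZ _ => f
  | .measX _ => f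

/-- The sites whose atom is missing when moment `n` is executed. -/
def lostAt (C : Circuit Q) (l : LossConfig Q) : ℕ → Q → Bool
  | 0 => l 0
  | n + 1 => fun q => (C n).foldl gateLost (lostAt C l n) q || l (n + 1) q

/-- `(-1) ^ z`. -/
noncomputable def sign (z : ZMod 2) : ℂ := if z = 0 then 1 else -1

/-- Tensor product of single-qubit Pauli operators, up to phase. -/
noncomputable def applyPauli [Fintype Q] (e : Q → Pauli) (ψ : State Q) : State Q :=
  fun b => sign (∑ q, (e q).2 * b q) * ψ (fun q => b q + (e q).1)

/-- One gate, on the branch in which the measurement results of the moment are `m`, when the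
atoms at the sites `lost` are missing. Gates on a lost atom are removed, and reading out a lost
atom leaves its result bit unconstrained. Discarding the old content of a prepared site is the
channel with Kraus operators `|0⟩⟨j|` (resp. `|+⟩⟨j|`), `j ∈ {0, 1}`, and `r` says which of them
occurs. -/
noncomputable def applyGate (lost : Q → Bool) (m r : Q → ZMod 2) (ψ : State Q) :
    Gate Q → State Q
  | .prepZ q => fun b => if b q = 0 then ψ (Function.update b q (r q)) else 0
  | .prepX q => fun b => ((Real.sqrt 2 : ℝ) : ℂ)⁻¹ * ψ (Function.update b q (r q))
  | .cnot c t =>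
      if lost c || lost t then ψ else fun b => ψ (Function.update b t (b t + b c))
  | .swap u v => fun b => ψ (b ∘ Equiv.swap u v)
  | .measZ q => if lost q then ψ else fun b => if b q = m q then ψ b else 0
  | .measX q =>
      if lost q then ψ
      else fun b => (ψ b + sign (m q) * ψ (Function.update b q (b q + 1))) / 2

/-- The unnormalized branch after the first `n` moments, with Pauli errors `p`, losses `l`,
measurement record `m` and Kraus branches `r`. -/
noncomputable def run [Fintype Q] (C : Circuit Q) (p : PauliConfig Q) (l : LossConfig Q)
    (m r : Record Q) (ψ : State Q) : ℕ → State Q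
  | 0 => ψ
  | n + 1 => (C n).foldl (applyGate (lostAt C l n) (m n) (r n))
      (applyPauli (p n) (run C p l m r ψ n))

/-- The measurement records that occur with positive probability in the first `N` moments. -/
def outcomes [Fintype Q] (C : Circuit Q) (N : ℕ) (ψ : State Q) (p : PauliConfig Q)
    (l : LossConfig Q) : Set (Record Q) :=
  {m | ∃ r : Record Q, run C p l m r ψ N ≠ 0}

def Measured (C : Circuit Q) (n : ℕ) (q : Q) : Prop :=
  Gate.measZ q ∈ C n ∨ Gate.measX q ∈ C n

/-- The loss-resolving readout of site `q` in moment `n` reports a lost atom. -/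
def LossDetected (C : Circuit Q) (l : LossConfig Q) (n : ℕ) (q : Q) : Prop :=
  Measured C n q ∧ lostAt C l n q = true

/-- In moment `n` a lost atom is the control of a (removed) CNOT. -/
def LostIsControl (C : Circuit Q) (l : LossConfig Q) (n : ℕ) : Prop :=
  ∃ q t, lostAt C l n q = true ∧ Gate.cnot q t ∈ C n

/-- In moment `n` a lost atom is the target of a (removed) CNOT. -/
def LostIsTarget (C : Circuit Q) (l : LossConfig Q) (n : ℕ) : Prop :=
  ∃ q c, lostAt C l n q = true ∧ Gate.cnot c q ∈ C n

/-- The CNOT of the lost atom in moment `n` and its preceding CNOT since the loss use the atom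
in different roles (control and target). Written with `CZ` and `H`, this is where a Hadamard
gate acts on the atom between the two gates. -/
def RoleChange (C : Circuit Q) (l : LossConfig Q) (n : ℕ) : Prop :=
  ∃ n' < n,
    ((LostIsControl C l n' ∧ LostIsTarget C l n) ∨
      (LostIsTarget C l n' ∧ LostIsControl C l n)) ∧
    ∀ k, n' < k → k < n → ¬ LostIsControl C l k ∧ ¬ LostIsTarget C l k

/-- The Pauli envelope of a single atom loss: arbitrary Pauli operators at the loss location, on
the lost atom's site at each of its role changes, and on it just before its readout; the
identity everywhere else. -/
def envelope (C : Circuit Q) (n₀ : ℕ) (q₀ : Q) : Set (PauliConfig Q) :=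
  {e | ∀ n q, e n q ≠ 0 →
    lostAt C (singleLoss n₀ q₀) n q = true ∧
      (n = n₀ ∨ RoleChange C (singleLoss n₀ q₀) n ∨ Measured C n q)}

/-- The records that a single atom loss can lead to: those of the circuit with the gates of the
lost atom removed, and those of the lossless circuit with an error from the Pauli envelope. -/
def lossOutcomes [Fintype Q] (C : Circuit Q) (N : ℕ) (ψ : State Q) (n₀ : ℕ) (q₀ : Q) :
    Set (Record Q) :=
  outcomes C N ψ noPauli (singleLoss n₀ q₀) ∪
    ⋃ e ∈ envelope C n₀ q₀, outcomes C N ψ e noLoss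

end Circuits

/-! ### The planar surface code

Rotated layout of distance `d`: data qubits at the points with odd coordinates in
`[0, 2 d] × [0, 2 d]`, stabilizer ancillas at points with even coordinates. The parity of `κ`
selects one of the two checkerboard colourings. The left and right boundaries carry `Z`-type and
the bottom and top boundaries `X`-type weight-two stabilizers, so that a horizontal row of `Z`
operators is a logical `Z`. -/

def IsDataPoint (d : ℕ) (p : ℤ × ℤ) : Prop :=
  p.1 % 2 = 1 ∧ p.2 % 2 = 1 ∧ 0 < p.1 ∧ p.1 < 2 * d ∧ 0 < p.2 ∧ p.2 < 2 * d

def IsZPoint (d : ℕ) (κ : ℤ) (p : ℤ × ℤ) : Prop :=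
  p.1 % 2 = 0 ∧ p.2 % 2 = 0 ∧ (p.1 + p.2 + 2 * κ) % 4 = 0 ∧
    0 ≤ p.1 ∧ p.1 ≤ 2 * d ∧ 0 < p.2 ∧ p.2 < 2 * d

def IsXPoint (d : ℕ) (κ : ℤ) (p : ℤ × ℤ) : Prop :=
  p.1 % 2 = 0 ∧ p.2 % 2 = 0 ∧ (p.1 + p.2 + 2 * κ) % 4 = 2 ∧
    0 < p.1 ∧ p.1 < 2 * d ∧ 0 ≤ p.2 ∧ p.2 ≤ 2 * d

instance (d : ℕ) : DecidablePred (IsDataPoint d) := fun p => by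
  unfold IsDataPoint; infer_instance

instance (d : ℕ) (κ : ℤ) : DecidablePred (IsZPoint d κ) := fun p => by
  unfold IsZPoint; infer_instance

instance (d : ℕ) (κ : ℤ) : DecidablePred (IsXPoint d κ) := fun p => by
  unfold IsXPoint; infer_instance

noncomputable def sites (d : ℕ) (κ : ℤ) : Finset (ℤ × ℤ) :=
  (Finset.Icc ((0 : ℤ), (0 : ℤ)) (2 * (d : ℤ), 2 * (d : ℤ))).filter
    (fun p => IsDataPoint d p ∨ IsZPoint d κ p ∨ IsXPoint d κ p)

abbrev Site (d : ℕ) (κ : ℤ) := {p : ℤ × ℤ // p ∈ sites d κ}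

section SurfaceCode

variable {d : ℕ} {κ : ℤ}

def IsZFace (s : Site d κ) : Prop := IsZPoint d κ s.1

def IsXFace (s : Site d κ) : Prop := IsXPoint d κ s.1

variable (d κ) in
noncomputable def zFaces : List (Site d κ) :=
  (Finset.univ.filter (fun s : Site d κ => IsZPoint d κ s.1)).toList

variable (d κ) in
noncomputable def xFaces : List (Site d κ) :=
  (Finset.univ.filter (fun s : Site d κ => IsXPoint d κ s.1)).toList

/-- The site at offset `δ` from `s`, as a list with at most one entry. -/
noncomputable def neighbor (s : Site d κ) (δ : ℤ × ℤ) : List (Site d κ) :=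
  if h : s.1 + δ ∈ sites d κ then [⟨s.1 + δ, h⟩] else []

/-- Order in which a `Z` ancilla visits its data qubits: NW, SW, NE, SE. -/
def zOrder : Fin 4 → ℤ × ℤ := ![(-1, 1), (-1, -1), (1, 1), (1, -1)]

/-- Order in which an `X` ancilla visits its data qubits: NW, NE, SW, SE. -/
def xOrder : Fin 4 → ℤ × ℤ := ![(-1, 1), (1, 1), (-1, -1), (1, -1)]

variable (d κ) in
/-- The `i`-th layer of CNOT gates of a syndrome extraction round. -/
noncomputable def cnotLayer (i : Fin 4) : List (Gate (Site d κ)) :=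
  ((zFaces d κ).flatMap fun s => (neighbor s (zOrder i)).map fun q => Gate.cnot q s) ++
    ((xFaces d κ).flatMap fun s => (neighbor s (xOrder i)).map fun q => Gate.cnot s q)

variable (d κ) in
/-- Each ancilla atom changes places with the data atom of its first CNOT (with no atom, if that
data qubit is missing at the boundary). -/
noncomputable def swapLayer : List (Gate (Site d κ)) :=
  ((zFaces d κ).flatMap fun s => (neighbor s (zOrder 0)).map fun q => Gate.swap s q) ++
    ((xFaces d κ).flatMap fun s => (neighbor s (xOrder 0)).map fun q => Gate.swap s q)

variable (d κ) in
/-- Mid-SWAP syndrome extraction, seven moments per round. -/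
noncomputable def midSwap : Circuit (Site d κ) := fun n =>
  match n % 7 with
  | 0 => (zFaces d κ).map Gate.prepZ ++ (xFaces d κ).map Gate.prepX
  | 1 => cnotLayer d κ 0
  | 2 => swapLayer d κ
  | 3 => cnotLayer d κ 1
  | 4 => cnotLayer d κ 2
  | 5 => cnotLayer d κ 3
  | _ => (zFaces d κ).map Gate.measZ ++ (xFaces d κ).map Gate.measX

/-- The moment in which the ancillas of round `c = 0, 1, 2, …` are read out. -/
def readoutMoment (c : ℕ) : ℕ := 7 * c + 6

/-- Indicator of the data qubits on which the stabilizer of the ancilla `s` acts. -/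
def stabilizerSupport (s q : Site d κ) : ZMod 2 :=
  if IsDataPoint d q.1 ∧ |q.1.1 - s.1.1| = 1 ∧ |q.1.2 - s.1.2| = 1 then 1 else 0

/-- `ψ` is a joint eigenvector of the `X` stabilizers with eigenvalues `(-1) ^ g s`. -/
def HasXSyndrome (ψ : State (Site d κ)) (g : Site d κ → ZMod 2) : Prop :=
  ∀ s, IsXFace s → ∀ b, ψ (b + stabilizerSupport s) = sign (g s) * ψ b

/-- The detector of the `X` stabilizer `s` in round `c`: the sum of two consecutive syndrome
bits, the bit before round `0` being the syndrome of the initial state. -/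
def detector (g : Site d κ → ZMod 2) (m : Record (Site d κ)) : ℕ → Site d κ → ZMod 2
  | 0, s => m (readoutMoment 0) s + g s
  | c + 1, s => m (readoutMoment (c + 1)) s + m (readoutMoment c) s

/-- The detector pattern `D` of an `R`-round experiment triggers the pair `S` of points of the
plane or nothing: all triggered `X` detectors lie above points of `S`, and the projection of
`D` to the plane (modulo two) is either empty or exactly `S`. A point of `S` that lies beyond
the boundary of the code carries no detector and is disregarded. -/
def TriggersAtMost (R : ℕ) (D : ℕ → Site d κ → ZMod 2) (S : Sym2 (ℤ × ℤ)) : Prop :=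
  (∀ c < R, ∀ u, IsXFace u → D c u ≠ 0 → u.1 ∈ S) ∧
    ((∀ u, IsXFace u → ∑ c ∈ Finset.range R, D c u = 0) ∨
      (∀ u, IsXFace u → (∑ c ∈ Finset.range R, D c u ≠ 0 ↔ u.1 ∈ S)))

/-- The configuration with the single Pauli error `e` on site `q` just before moment `n`. -/
def singlePauli (n : ℕ) (q : Site d κ) (e : Pauli) : PauliConfig (Site d κ) :=
  fun n' q' => if n' = n ∧ q' = q then e else 0

/-- In the lossless `R`-round experiment, the single Pauli error `e` at `(n, q)` triggers
exactly the `X` detectors in `F`. -/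
def PauliTriggers (R n : ℕ) (q : Site d κ) (e : Pauli) (F : Set (ℕ × Site d κ)) : Prop :=
  ∀ (ψ : State (Site d κ)) (g : Site d κ → ZMod 2), HasXSyndrome ψ g →
    ∀ m ∈ outcomes (midSwap d κ) (7 * R) ψ (singlePauli n q e) noLoss,
      ∀ c < R, ∀ u, IsXFace u → (detector g m c u ≠ 0 ↔ (c, u) ∈ F)

variable (d κ) in
/-- The matching graph for `X` detectors of the `R`-round experiment, projected to the plane:
`u` and `v` are joined if some single Pauli error triggers exactly one detector above `u` and
one above `v`. -/
def matchingGraph (R : ℕ) : SimpleGraph (Site d κ) where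
  Adj u v := u ≠ v ∧ IsXFace u ∧ IsXFace v ∧
    ∃ n < 7 * R, ∃ (q : Site d κ) (e : Pauli), ∃ c < R, ∃ c' < R,
      PauliTriggers R n q e {(c, u), (c', v)}
  symm := by
    refine { symm := ?_ }
    rintro u v ⟨h, hu, hv, n, hn, q, e, c, hc, c', hc', H⟩
    exact ⟨h.symm, hv, hu, n, hn, q, e, c', hc', c, hc, by rwa [Set.pair_comm]⟩
  loopless := ⟨fun _ h => h.1 rfl⟩

variable (d κ) in
/-- Whenever both points of `S` carry `X` stabilizers, `S` is an edge of the matching graph. -/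
def IsMatchingEdge (R : ℕ) (S : Sym2 (ℤ × ℤ)) : Prop :=
  ∀ u v : Site d κ, IsXFace u → IsXFace v → s(u.1, v.1) = S → (matchingGraph d κ R).Adj u v

end SurfaceCode

/-- `((x - 2, y), (x, y + 2))`: diagonal, from left to top. -/
def S₁ (x y : ℤ) : Sym2 (ℤ × ℤ) := s((x - 2, y), (x, y + 2))

/-- `((x, y + 2), (x, y - 2))`: vertical, from top to bottom. -/
def S₂ (x y : ℤ) : Sym2 (ℤ × ℤ) := s((x, y + 2), (x, y - 2))

/-- `((x, y - 2), (x + 2, y))`: diagonal, from bottom to right. -/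
def S₃ (x y : ℤ) : Sym2 (ℤ × ℤ) := s((x, y - 2), (x + 2, y))

/-- `((x - 2, y), (x, y - 2))`. -/
def S₄ (x y : ℤ) : Sym2 (ℤ × ℤ) := s((x - 2, y), (x, y - 2))

end MidSwap

namespace MidSwap

/-! ### Eigenvectors of `X`-type operators under single gates -/

section Stabilizers

variable {Q : Type}

/-! Follow `X`-type operators through the circuit. A parity of `X` results, traced back from the
readouts, gives a family of supports `V n` (`IsFlow`) that starts as a product of `X` stabilizers
and ends as the identity. In every branch the state is an eigenvector of `X ^ V n`. The eigenvalue
changes only through the measured bits and through `Z` errors lying on `V n`. A nonzero final state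
has eigenvalue `+1` for the identity, so the parity is the initial syndrome plus the number of `Z`
errors met by `V`, modulo two (`sum_readout_eq`).

The same argument works with missing atoms once `V n` is restricted to the atoms present, provided
`V` vanishes at the loss, where the lost atom would control a CNOT, and at its readout. A lost
target costs nothing: an `X` on a target spreads nowhere, and an `X` that would be copied onto it is
dropped by the restriction. Thus a single condition on the history of the lost atom covers both the
circuit with removed gates and the Pauli envelope (`readoutSum_of_mem_lossOutcomes`).

The flow of one result is explicit: `flipNow` in its own round, `flipLater` in earlier rounds.
Suppose every place of the lost atom is harmless or affects only faces of `S`, all equally in later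
rounds. Then the detectors off `S` are silent. The projection at a face telescopes to its last
result plus its initial syndrome, and the flows of the last results at two faces of `S` agree before
the last round, so they cancel on the lost atom. Hence the projection is constant on `S`
(`triggersAtMost_of_affectsOnly`).

It remains to locate the atom (`location_of_lost`). After its first CNOT a fresh ancilla is in a
state symmetric under exchange with its data atom, so shuttling makes the ancilla atom the northwest
data atom, which is read out one round later. A `Z` error at the northwest data site touches `S₁`,
or `S₄` if the face has type `X`. Once the atom serves as a `Z` ancilla, a `Z` error spreads to the
data qubits not yet visited: SW, NE, SE gives `S₁` up to the stabilizer, NE, SE gives `S₂`, and SE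
alone gives `S₃`. The atom stays a target from then on, so only the loss time and a role change at
the second CNOT matter, and a single pair suffices. The same errors realize the edges of the
matching graph. -/

lemma sign_add (a b : ZMod 2) : sign (a + b) = sign a * sign b := by
  revert a b
  have h : ∀ a : ZMod 2, a = 0 ∨ a = 1 := by decide
  intro a b
  have e : (1 : ZMod 2) + 1 = 0 := by decide
  rcases h a with rfl | rfl <;> rcases h b with rfl | rfl <;> simp [sign, e]

lemma sign_mul_self (a : ZMod 2) : sign a * sign a = 1 := by
  unfold sign; split_ifs <;> simp

/-- `ψ` is an eigenvector of `X ^ v` with eigenvalue `(-1) ^ α`. -/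
def Eig (ψ : State Q) (v : Q → ZMod 2) (α : ZMod 2) : Prop :=
  ∀ b, ψ (b + v) = sign α * ψ b

lemma Eig.zero (ψ : State Q) : Eig ψ 0 0 := fun b => by simp [sign]

lemma Eig.add {ψ : State Q} {v w : Q → ZMod 2} {α β : ZMod 2} (hv : Eig ψ v α)
    (hw : Eig ψ w β) : Eig ψ (v + w) (α + β) := fun b => by
  rw [← add_assoc, hw, hv, sign_add]; ring

/-- The eigenvalue `-1` of the identity forces the zero vector. All parity constraints on results
that occur come from this. -/
lemma Eig.eq_zero {ψ : State Q} {α : ZMod 2} (h : Eig ψ 0 α) (hψ : ψ ≠ 0) : α = 0 := by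
  by_contra hα
  apply hψ
  funext b
  have := h b
  simp only [add_zero, sign, hα, if_false] at this
  have h2 : (2 : ℂ) * ψ b = 0 := by linear_combination this
  simpa using h2

lemma Eig.sum {ψ : State Q} {ι : Type*} (s : Finset ι) (v : ι → Q → ZMod 2) (α : ι → ZMod 2)
    (h : ∀ i ∈ s, Eig ψ (v i) (α i)) : Eig ψ (∑ i ∈ s, v i) (∑ i ∈ s, α i) := by
  classical
  induction s using Finset.induction_on with
  | empty => simpa using Eig.zero ψ
  | insert i s hi ih =>
    rw [Finset.sum_insert hi, Finset.sum_insert hi]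
    exact (h i (by simp)).add (ih fun j hj => h j (by simp [hj]))

/-- The `X` part of the error commutes with `X ^ v`; the `Z` part contributes one sign for each
common site. -/
lemma Eig.applyPauli [Fintype Q] {ψ : State Q} {v : Q → ZMod 2} {α : ZMod 2} (h : Eig ψ v α)
    (e : Q → Pauli) : Eig (MidSwap.applyPauli e ψ) v (α + ∑ q, v q * (e q).2) := by
  intro b
  have h1 : ∑ q, (e q).2 * (b + v) q = ∑ q, v q * (e q).2 + ∑ q, (e q).2 * b q := by
    rw [← Finset.sum_add_distrib]
    exact Finset.sum_congr rfl fun q _ => by simp only [Pi.add_apply]; ring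
  have h2 : (fun q => (b + v) q + (e q).1) = (fun q => b q + (e q).1) + v := by
    funext q; simp only [Pi.add_apply]; ring
  simp only [MidSwap.applyPauli, h1, h2, h _, sign_add]
  ring

variable [DecidableEq Q]

/-- The support after a CNOT or swap gate of an `X`-type operator with support `w` before it. -/
def gateFlow (lost : Q → Bool) (w : Q → ZMod 2) : Gate Q → Q → ZMod 2
  | .cnot c t => if lost c || lost t then w else Function.update w t (w t + w c)
  | .swap u v => w ∘ Equiv.swap u v
  | _ => w

/-- Conjugation by a CNOT copies an `X` from the control to the target and leaves an `X` on the
target alone. -/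
lemma Eig.cnot {ψ : State Q} {w : Q → ZMod 2} {α : ZMod 2} (h : Eig ψ w α)
    (lost : Q → Bool) (m r : Q → ZMod 2) {c t : Q} (hct : c ≠ t) :
    Eig (applyGate lost m r ψ (.cnot c t)) (gateFlow lost w (.cnot c t)) α := by
  by_cases hl : (lost c || lost t) = true
  · simpa [applyGate, gateFlow, hl] using h
  · simp only [applyGate, gateFlow, hl]
    intro b
    simp only [Bool.false_eq_true, if_false]
    rw [← h]
    congr 1
    funext q
    have e : w c + w c = 0 := CharTwo.add_self_eq_zero _
    by_cases hq : q = t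
    · subst hq
      simp only [Function.update_self, Pi.add_apply, Function.update_of_ne hct]
      linear_combination e
    · simp [hq]

lemma Eig.swap {ψ : State Q} {w : Q → ZMod 2} {α : ZMod 2} (h : Eig ψ w α)
    (lost : Q → Bool) (m r : Q → ZMod 2) (u v : Q) :
    Eig (applyGate lost m r ψ (.swap u v)) (gateFlow lost w (.swap u v)) α := by
  intro b
  simp only [applyGate, gateFlow]
  rw [← h]
  congr 1
  funext q
  simp

/-- An operator that avoids `q` commutes with every Kraus operator of the reload, so the branch `r`
is irrelevant. -/
lemma Eig.prepZ {ψ : State Q} {w : Q → ZMod 2} {α : ZMod 2} (h : Eig ψ w α)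
    (lost : Q → Bool) (m r : Q → ZMod 2) {q : Q} (hq : w q = 0) :
    Eig (applyGate lost m r ψ (.prepZ q)) w α := by
  intro b
  have e : Function.update (b + w) q (r q) = Function.update b q (r q) + w := by
    funext q'
    by_cases hq' : q' = q
    · subst hq'; simp [hq]
    · simp [hq']
  simp only [applyGate, Pi.add_apply, hq, add_zero, e, h _]
  split_ifs <;> simp

lemma Eig.prepX {ψ : State Q} {w : Q → ZMod 2} {α : ZMod 2} (h : Eig ψ w α)
    (lost : Q → Bool) (m r : Q → ZMod 2) {q : Q} (hq : w q = 0) :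
    Eig (applyGate lost m r ψ (.prepX q)) w α := by
  intro b
  have e : Function.update (b + w) q (r q) = Function.update b q (r q) + w := by
    funext q'
    by_cases hq' : q' = q
    · subst hq'; simp [hq]
    · simp [hq']
  simp only [applyGate, e, h _]
  ring

/-- The fresh `|+⟩` is stabilized by `X` whatever the input and the Kraus branch, so this eigenvalue
needs no hypothesis on `ψ`. -/
lemma Eig.prepX_self (ψ : State Q) (lost : Q → Bool) (m r : Q → ZMod 2) (q : Q) :
    Eig (applyGate lost m r ψ (.prepX q)) (Pi.single q 1) 0 := by
  intro b
  have e : Function.update (b + Pi.single q 1) q (r q) = Function.update b q (r q) := by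
    funext q'
    by_cases hq' : q' = q
    · subst hq'; simp
    · simp [hq']
  simp [applyGate, e, sign]

lemma Eig.measZ {ψ : State Q} {w : Q → ZMod 2} {α : ZMod 2} (h : Eig ψ w α)
    (lost : Q → Bool) (m r : Q → ZMod 2) {q : Q} (hq : w q = 0) :
    Eig (applyGate lost m r ψ (.measZ q)) w α := by
  by_cases hl : lost q = true
  · simpa [applyGate, hl] using h
  · intro b
    simp only [applyGate, hl, Bool.false_eq_true, if_false, Pi.add_apply, hq, add_zero, h _]
    split_ifs <;> simp

lemma update_add_one (b : Q → ZMod 2) (q : Q) :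
    Function.update b q (b q + 1) = b + Pi.single q 1 := by
  funext q'
  by_cases hq' : q' = q
  · subst hq'; simp
  · simp [hq']

lemma Eig.measX {ψ : State Q} {w : Q → ZMod 2} {α : ZMod 2} (h : Eig ψ w α)
    (lost : Q → Bool) (m r : Q → ZMod 2) (q : Q) :
    Eig (applyGate lost m r ψ (.measX q)) w α := by
  by_cases hl : lost q = true
  · simpa [applyGate, hl] using h
  · intro b
    simp only [applyGate, hl, Bool.false_eq_true, if_false, update_add_one,
      add_right_comm b w, h _]
    ring

/-- The projector onto the result `m q` absorbs `X` at `q` up to the sign of the result. A missing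
atom applies no projector, hence `hl`. -/
lemma Eig.measX_self (ψ : State Q) (lost : Q → Bool) (m r : Q → ZMod 2) {q : Q}
    (hl : lost q = false) :
    Eig (applyGate lost m r ψ (.measX q)) (Pi.single q 1) (m q) := by
  intro b
  have e : b + Pi.single q 1 + Pi.single q 1 = b := by
    funext q'; rw [Pi.add_apply, Pi.add_apply, add_assoc, CharTwo.add_self_eq_zero, add_zero]
  simp only [applyGate, hl, Bool.false_eq_true, if_false, update_add_one, e]
  linear_combination (-(1 / 2 : ℂ) * ψ (b + Pi.single q 1)) * sign_mul_self (m q)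

/-- An invariant of all gates of a list that is established by one of them holds afterwards. -/
lemma foldl_of_mem {σ γ : Type*} {P : σ → Prop} {step : σ → γ → σ} {L : List γ} {g₀ : γ}
    (h : ∀ g ∈ L, ∀ ψ, P ψ → P (step ψ g)) (hg : g₀ ∈ L) (h₀ : ∀ ψ, P (step ψ g₀)) (ψ : σ) :
    P (L.foldl step ψ) := by
  have keep : ∀ (L : List γ), (∀ g ∈ L, ∀ ψ, P ψ → P (step ψ g)) → ∀ ψ, P ψ →
      P (L.foldl step ψ) := by
    intro L
    induction L with
    | nil => intro _ ψ hψ; exact hψ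
    | cons g L ih =>
      intro h ψ hψ
      exact ih (fun g' hg' => h g' (by simp [hg'])) _ (h g (by simp) ψ hψ)
  induction L generalizing ψ with
  | nil => simp at hg
  | cons g L ih =>
    rcases List.mem_cons.1 hg with rfl | hg
    · exact keep L (fun g' hg' => h g' (by simp [hg'])) _ (h₀ ψ)
    · exact ih (fun g' hg' => h g' (by simp [hg'])) hg _

lemma foldl_invariant {σ γ : Type*} {P : σ → Prop} {step : σ → γ → σ} {L : List γ}
    (h : ∀ g ∈ L, ∀ ψ, P ψ → P (step ψ g)) {ψ : σ} (hψ : P ψ) : P (L.foldl step ψ) := by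
  induction L generalizing ψ with
  | nil => exact hψ
  | cons g L ih => exact ih (fun g' hg' => h g' (by simp [hg'])) (h g (by simp) ψ hψ)

/-- CNOTs with distinct qubits and swaps propagate `X`-type operators along `gateFlow`. -/
lemma Eig.foldl_gateFlow {ψ : State Q} {w : Q → ZMod 2} {α : ZMod 2} (lost : Q → Bool)
    (m r : Q → ZMod 2) (L : List (Gate Q))
    (hL : ∀ g ∈ L, (∃ c t, c ≠ t ∧ g = .cnot c t) ∨ ∃ u v, g = .swap u v) (h : Eig ψ w α) :
    Eig (L.foldl (applyGate lost m r) ψ) (L.foldl (gateFlow lost) w) α := by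
  induction L generalizing ψ w with
  | nil => exact h
  | cons g L ih =>
    refine ih (fun g' hg' => hL g' (by simp [hg'])) ?_
    rcases hL g (by simp) with ⟨c, t, hct, rfl⟩ | ⟨u, v, rfl⟩
    · exact h.cnot lost m r hct
    · exact h.swap lost m r u v

/-- What a CNOT adds at the site `q` to an `X`-type operator with support `w`. -/
def cnotTerm (lost : Q → Bool) (w : Q → ZMod 2) (q : Q) : Gate Q → ZMod 2
  | .cnot c t => if lost c || lost t then 0 else if q = t then w c else 0
  | _ => 0

/-- In a layer of CNOTs in which no target is a control the gates act independently. -/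
lemma foldl_gateFlow_cnot (lost : Q → Bool) (w : Q → ZMod 2) (L : List (Gate Q))
    (hL : ∀ g ∈ L, ∃ c t, g = .cnot c t)
    (hd : ∀ c t c' t', Gate.cnot c t ∈ L → Gate.cnot c' t' ∈ L → t ≠ c') (q : Q) :
    L.foldl (gateFlow lost) w q = w q + (L.map (cnotTerm lost w q)).sum := by
  induction L generalizing w with
  | nil => simp
  | cons g L ih =>
    obtain ⟨c, t, rfl⟩ := hL g (by simp)
    have hc : L.map (cnotTerm lost (gateFlow lost w (.cnot c t)) q)
        = L.map (cnotTerm lost w q) := by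
      refine List.map_congr_left fun g' hg' => ?_
      obtain ⟨c', t', rfl⟩ := hL g' (by simp [hg'])
      -- The first gate changes the support only at `t`, which controls no later gate of the layer,
      -- so all other terms can be computed from the initial support.
      have hne : c' ≠ t := (hd c t c' t' (by simp) (by simp [hg'])).symm
      simp only [cnotTerm, gateFlow]
      by_cases hl : (lost c || lost t) = true <;> simp [hl, hne]
    rw [List.foldl_cons, ih _ (fun g' hg' => hL g' (by simp [hg']))
      (fun c t c' t' h h' => hd c t c' t' (by simp [h]) (by simp [h'])), hc, List.map_cons,
      List.sum_cons, ← add_assoc]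
    congr 1
    simp only [cnotTerm, gateFlow]
    by_cases hl : (lost c || lost t) = true
    · simp [hl]
    · by_cases hq : q = t
      · subst hq; simp [hl]
      · simp [hl, hq]

end Stabilizers

/-! ### Layers of gates on the lattice -/

section SurfaceCode

variable {d : ℕ} {κ : ℤ}

lemma mem_sites {p : ℤ × ℤ} :
    p ∈ sites d κ ↔ IsDataPoint d p ∨ IsZPoint d κ p ∨ IsXPoint d κ p := by
  rw [sites, Finset.mem_filter, Finset.mem_Icc, Prod.le_def, Prod.le_def]
  simp only [IsDataPoint, IsZPoint, IsXPoint]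
  constructor
  · exact fun h => h.2
  · exact fun h => ⟨by omega, h⟩

lemma mem_neighbor {s q : Site d κ} {δ : ℤ × ℤ} : q ∈ neighbor s δ ↔ q.1 = s.1 + δ := by
  unfold neighbor
  split_ifs with h
  · simp [Subtype.ext_iff]
  · simp only [List.not_mem_nil, false_iff]
    exact fun e => h (e ▸ q.2)

lemma mem_zFaces {s : Site d κ} : s ∈ zFaces d κ ↔ IsZPoint d κ s.1 := by simp [zFaces]

lemma mem_xFaces {s : Site d κ} : s ∈ xFaces d κ ↔ IsXPoint d κ s.1 := by simp [xFaces]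

lemma mem_cnotLayer {i : Fin 4} {c t : Site d κ} :
    Gate.cnot c t ∈ cnotLayer d κ i ↔ (IsZPoint d κ t.1 ∧ c.1 = t.1 + zOrder i) ∨
      (IsXPoint d κ c.1 ∧ t.1 = c.1 + xOrder i) := by
  simp only [cnotLayer, List.mem_append, List.mem_flatMap, List.mem_map, mem_neighbor, mem_zFaces,
    mem_xFaces, Gate.cnot.injEq]
  constructor
  · rintro (⟨s, hs, q, hq, rfl, rfl⟩ | ⟨s, hs, q, hq, rfl, rfl⟩)
    exacts [.inl ⟨hs, hq⟩, .inr ⟨hs, hq⟩]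
  · rintro (⟨hs, hq⟩ | ⟨hs, hq⟩)
    exacts [.inl ⟨t, hs, c, hq, rfl, rfl⟩, .inr ⟨c, hs, t, hq, rfl, rfl⟩]

lemma exists_cnot_of_mem_cnotLayer {i : Fin 4} {g : Gate (Site d κ)} (h : g ∈ cnotLayer d κ i) :
    ∃ c t, g = .cnot c t := by
  simp only [cnotLayer, List.mem_append, List.mem_flatMap, List.mem_map] at h
  rcases h with ⟨s, hs, q, hq, rfl⟩ | ⟨s, hs, q, hq, rfl⟩
  exacts [⟨_, _, rfl⟩, ⟨_, _, rfl⟩]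

/-- No site is a target and a control in the same layer. -/
lemma target_ne_control {i : Fin 4} {c t c' t' : Site d κ} (h : Gate.cnot c t ∈ cnotLayer d κ i)
    (h' : Gate.cnot c' t' ∈ cnotLayer d κ i) : t ≠ c' := by
  rintro rfl
  rw [mem_cnotLayer] at h h'
  fin_cases i <;>
    simp only [IsZPoint, IsXPoint, zOrder, xOrder, Prod.ext_iff, Prod.fst_add, Prod.snd_add,
      Fin.zero_eta, Fin.mk_one, Fin.reduceFinMk, Matrix.cons_val] at h h' <;> omega

/-- The restriction to the sites whose atom is present. -/
def mask (lost : Site d κ → Bool) (W : ℤ × ℤ → ZMod 2) (q : Site d κ) : ZMod 2 :=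
  if lost q then 0 else W q.1

variable (d κ) in
/-- Propagation of an `X`-type operator through the `i`-th layer of CNOTs. -/
def layerFlow (i : Fin 4) (W : ℤ × ℤ → ZMod 2) (p : ℤ × ℤ) : ZMod 2 :=
  W p +
    ((if IsZPoint d κ p ∧ IsDataPoint d (p + zOrder i) then W (p + zOrder i) else 0) +
      if IsDataPoint d p ∧ IsXPoint d κ (p - xOrder i) then W (p - xOrder i) else 0)

lemma isDataPoint_add_zOrder {i : Fin 4} {p : ℤ × ℤ} (hp : IsZPoint d κ p)
    (h : p + zOrder i ∈ sites d κ) : IsDataPoint d (p + zOrder i) := by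
  rw [mem_sites] at h
  fin_cases i <;>
    simp only [IsDataPoint, IsZPoint, IsXPoint, zOrder, Prod.fst_add, Prod.snd_add,
      Fin.zero_eta, Fin.mk_one, Fin.reduceFinMk, Matrix.cons_val] at h hp ⊢ <;> omega

lemma isDataPoint_add_xOrder {i : Fin 4} {p : ℤ × ℤ} (hp : IsXPoint d κ p)
    (h : p + xOrder i ∈ sites d κ) : IsDataPoint d (p + xOrder i) := by
  rw [mem_sites] at h
  fin_cases i <;>
    simp only [IsDataPoint, IsZPoint, IsXPoint, xOrder, Prod.fst_add, Prod.snd_add,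
      Fin.zero_eta, Fin.mk_one, Fin.reduceFinMk, Matrix.cons_val] at h hp ⊢ <;> omega

lemma sum_flatMap {ι M : Type*} [AddCommMonoid M] (L : List ι) (f : ι → List M) :
    (L.flatMap f).sum = (L.map fun i => (f i).sum).sum := by
  induction L with
  | nil => simp
  | cons i L ih => simp [ih]

/-- A removed CNOT has either a lost control, which by `h` had nothing to copy, or a lost target,
where the mask discards what would be copied. So the masked support evolves as in the lossless
layer. -/
lemma foldl_cnotLayer {lost : Site d κ → Bool} {W : ℤ × ℤ → ZMod 2} {i : Fin 4}
    (h : ∀ c t, Gate.cnot c t ∈ cnotLayer d κ i → lost c = true → W c.1 = 0) :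
    (cnotLayer d κ i).foldl (gateFlow lost) (mask lost W) = mask lost (layerFlow d κ i W) := by
  funext q
  rw [foldl_gateFlow_cnot _ _ _ (fun g => exists_cnot_of_mem_cnotLayer)
    fun _ _ _ _ => target_ne_control]
  by_cases hq : lost q = true
  · have hsum : ((cnotLayer d κ i).map (cnotTerm lost (mask lost W) q)).sum = 0 := by
      apply List.sum_eq_zero
      simp only [List.mem_map]
      rintro _ ⟨g, hg, rfl⟩
      obtain ⟨c, t, rfl⟩ := exists_cnot_of_mem_cnotLayer hg
      simp only [cnotTerm]
      split_ifs with h1 h2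
      · rfl
      · subst h2; simp [hq] at h1
      · rfl
    simp [hsum, mask, hq]
  · have hterm : (cnotLayer d κ i).map (cnotTerm lost (mask lost W) q)
        = (cnotLayer d κ i).map fun g => match g with
          | .cnot c t => if q = t then W c.1 else 0
          | _ => 0 := by
      refine List.map_congr_left fun g hg => ?_
      obtain ⟨c, t, rfl⟩ := exists_cnot_of_mem_cnotLayer hg
      simp only [cnotTerm, mask]
      by_cases ht : q = t
      · subst ht
        by_cases hc : lost c = true
        · simp [hc, h c q hg hc]
        · simp [hc, hq]
      · simp [ht]
    rw [hterm, cnotLayer, List.map_append, List.sum_append, List.map_flatMap, List.map_flatMap,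
      sum_flatMap, sum_flatMap, zFaces, xFaces, Finset.sum_map_toList,
      Finset.sum_map_toList]
    simp only [mask, hq, layerFlow, Bool.false_eq_true, if_false]
    congr 1
    congr 1
    · by_cases hz : IsZPoint d κ q.1
      -- Of all CNOTs belonging to `Z` faces, only the one of the face `q` itself has target `q`.
      · rw [Finset.sum_eq_single q]
        · by_cases hn : q.1 + zOrder i ∈ sites d κ
          · have := isDataPoint_add_zOrder hz hn
            simp [neighbor, hn, hz, this]
          · have : ¬ IsDataPoint d (q.1 + zOrder i) := fun h => hn (mem_sites.2 (.inl h))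
            simp [neighbor, hn, this]
        · intro s _ hs
          by_cases hn : s.1 + zOrder i ∈ sites d κ <;> simp [neighbor, hn, hs.symm]
        · intro hz'; simp [hz] at hz'
      · rw [Finset.sum_eq_zero]
        · simp [hz]
        · intro s hs
          have hs' : q ≠ s := by rintro rfl; simp [hz] at hs
          by_cases hn : s.1 + zOrder i ∈ sites d κ <;> simp [neighbor, hn, hs']
    · by_cases hx : IsXPoint d κ (q.1 - xOrder i)
      · have hd : IsDataPoint d q.1 := by
          have := isDataPoint_add_xOrder (i := i) hx (by simp)
          simpa using this
        -- In a given layer a data qubit is the target of at most one `X` face, the one at offset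
        -- `-xOrder i`.
        rw [Finset.sum_eq_single ⟨q.1 - xOrder i, mem_sites.2 (.inr (.inr hx))⟩]
        · simp [neighbor, hx, hd]
        · intro s _ hs
          by_cases hn : s.1 + xOrder i ∈ sites d κ
          · have : q ≠ ⟨s.1 + xOrder i, hn⟩ := by
              rintro rfl; apply hs; simp
            simp [neighbor, hn, this]
          · simp [neighbor, hn]
        · intro hx'; simp [hx] at hx'
      · rw [Finset.sum_eq_zero]
        · simp [hx]
        · intro s hs
          by_cases hn : s.1 + xOrder i ∈ sites d κ
          · have : q ≠ ⟨s.1 + xOrder i, hn⟩ := by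
              rintro rfl; apply hx; simpa using hs
            simp [neighbor, hn, this]
          · simp [neighbor, hn]

variable (d κ) in
def IsFacePoint (p : ℤ × ℤ) : Prop := IsZPoint d κ p ∨ IsXPoint d κ p

instance : DecidablePred (IsFacePoint d κ) := fun p => by
  unfold IsFacePoint; infer_instance

lemma site_cases (q : Site d κ) :
    IsDataPoint d q.1 ∨ IsZPoint d κ q.1 ∨ IsXPoint d κ q.1 := mem_sites.1 q.2

lemma IsDataPoint.not_face {p : ℤ × ℤ} (h : IsDataPoint d p) : ¬ IsFacePoint d κ p := by
  simp only [IsFacePoint, IsDataPoint, IsZPoint, IsXPoint] at *; omega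

lemma IsZPoint.not_isXPoint {p : ℤ × ℤ} (h : IsZPoint d κ p) : ¬ IsXPoint d κ p := by
  simp only [IsZPoint, IsXPoint] at *; omega

variable (d κ) in
/-- The point to which the shuttling of a round moves the atom at `p`. -/
def swapPoint (p : ℤ × ℤ) : ℤ × ℤ :=
  if IsFacePoint d κ p ∧ IsDataPoint d (p + (-1, 1)) then p + (-1, 1)
  else if IsDataPoint d p ∧ IsFacePoint d κ (p + (1, -1)) then p + (1, -1)
  else p

lemma swapPoint_mem_sites {p : ℤ × ℤ} (h : p ∈ sites d κ) : swapPoint d κ p ∈ sites d κ := by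
  unfold swapPoint
  split_ifs with h1 h2
  · exact mem_sites.2 (.inl h1.2)
  · exact mem_sites.2 (.inr h2.2)
  · exact h

def swapSite (q : Site d κ) : Site d κ := ⟨swapPoint d κ q.1, swapPoint_mem_sites q.2⟩

lemma swapPoint_swapPoint (p : ℤ × ℤ) : swapPoint d κ (swapPoint d κ p) = p := by
  by_cases h1 : IsFacePoint d κ p ∧ IsDataPoint d (p + (-1, 1))
  · have e : p + (-1, 1) + (1, -1) = p := by ext <;> simp
    have h2 : ¬ IsFacePoint d κ (p + (-1, 1)) := h1.2.not_face
    simp [swapPoint, h1, h2, e]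
  · by_cases h2 : IsDataPoint d p ∧ IsFacePoint d κ (p + (1, -1))
    · have e : p + (1, -1) + (-1, 1) = p := by ext <;> simp
      simp only [swapPoint, h1, h2, e, and_self, if_true, if_false]
    · simp only [swapPoint, h1, h2, if_false]

lemma swapSite_swapSite (q : Site d κ) : swapSite (swapSite q) = q :=
  Subtype.ext (swapPoint_swapPoint q.1)

/-- Distinct faces have distinct northwest data sites, and faces are never data sites, so the
transpositions are disjoint and each site is moved at most once. -/
lemma foldl_swaps {β : Type*} {step : (Site d κ → β) → Gate (Site d κ) → Site d κ → β}
    (hstep : ∀ f u v, step f (.swap u v) = f ∘ Equiv.swap u v) (F : List (Site d κ))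
    (hF : F.Nodup) (hface : ∀ s ∈ F, IsFacePoint d κ s.1) (f : Site d κ → β) (q : Site d κ) :
    (F.flatMap fun s => (neighbor s (-1, 1)).map fun q => Gate.swap s q).foldl step f q =
      if q ∈ F ∨ ∃ s ∈ F, q.1 = s.1 + (-1, 1) then f (swapSite q) else f q := by
  induction F generalizing f with
  | nil => simp
  | cons s F ih =>
    obtain ⟨hsF, hF⟩ := List.nodup_cons.1 hF
    have hs : IsFacePoint d κ s.1 := hface s (by simp)
    have hface' : ∀ s ∈ F, IsFacePoint d κ s.1 := fun s' h' => hface s' (by simp [h'])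
    have even : ∀ p, IsFacePoint d κ p → ¬ IsDataPoint d p := fun p h h' => h'.not_face h
    have hdata : ∀ s' : Site d κ, IsFacePoint d κ s'.1 → ∀ q : Site d κ, q.1 = s'.1 + (-1, 1) →
        IsDataPoint d q.1 := by
      intro s' hs' q hq
      rcases site_cases q with h | h | h
      · exact h
      all_goals
        rw [hq] at h
        simp only [IsFacePoint, IsZPoint, IsXPoint, Prod.fst_add, Prod.snd_add] at hs' h
        omega
    rw [List.flatMap_cons, List.foldl_append, ih hF hface']
    by_cases hn : s.1 + (-1, 1) ∈ sites d κ
    · set q' : Site d κ := ⟨s.1 + (-1, 1), hn⟩ with hq'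
      have hnb : neighbor s (-1, 1) = [q'] := by simp [neighbor, hn, hq']
      have hq'd : IsDataPoint d q'.1 := hdata s hs q' rfl
      have hsq : swapSite s = q' := Subtype.ext (by
        have : IsDataPoint d (s.1 + (-1, 1)) := hq'd
        simp [swapSite, swapPoint, hs, this, hq'])
      have hqs : swapSite q' = s := by rw [← hsq, swapSite_swapSite]
      simp only [hnb, List.map_cons, List.map_nil, List.foldl_cons, List.foldl_nil, hstep,
        Function.comp_apply]
      -- The remaining swaps touch neither `s` nor its partner `q'`.
      have hsc : ¬ (s ∈ F ∨ ∃ s' ∈ F, s.1 = s'.1 + (-1, 1)) := by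
        rintro (h | ⟨s', h, e⟩)
        · exact hsF h
        · exact even _ hs (hdata s' (hface' s' h) s e)
      have hqc : ¬ (q' ∈ F ∨ ∃ s' ∈ F, q'.1 = s'.1 + (-1, 1)) := by
        rintro (h | ⟨s', h, e⟩)
        · exact even _ (hface' _ h) hq'd
        · have : s = s' := Subtype.ext (add_right_cancel (show s.1 + (-1, 1) = _ from e))
          exact hsF (this ▸ h)
      by_cases h1 : q = s
      · subst h1
        rw [if_neg hsc, if_pos (by simp), Equiv.swap_apply_left, hsq]
      by_cases h2 : q = q'
      · subst h2
        rw [if_neg hqc, if_pos (.inr ⟨s, by simp, rfl⟩), Equiv.swap_apply_right, hqs]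
      have h2' : q.1 ≠ s.1 + (-1, 1) := fun e => h2 (Subtype.ext e)
      have h3 : swapSite q ≠ s := fun e => h2 (by rw [← hsq, ← e, swapSite_swapSite])
      have h4 : swapSite q ≠ q' := fun e => h1 (by rw [← hqs, ← e, swapSite_swapSite])
      rw [Equiv.swap_apply_of_ne_of_ne h3 h4, Equiv.swap_apply_of_ne_of_ne h1 h2]
      exact if_congr (by simp [h1, h2']) rfl rfl
    · have hnb : neighbor s (-1, 1) = [] := by simp [neighbor, hn]
      have hne : q.1 ≠ s.1 + (-1, 1) := fun e => hn (e ▸ q.2)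
      simp only [hnb, List.map_nil, List.foldl_nil]
      by_cases h1 : q = s
      · subst h1
        have : swapSite q = q := Subtype.ext (by
          have : ¬ IsDataPoint d (q.1 + (-1, 1)) := fun h => hn (mem_sites.2 (.inl h))
          have h' : ¬ IsDataPoint d q.1 := even _ hs
          simp [swapSite, swapPoint, this, h'])
        simp [this]
      · exact if_congr (by simp [h1, hne]) rfl rfl

/-- Stated for an arbitrary `step` because it is applied both to vacancies (`gateLost`) and to
supports (`gateFlow`). -/
lemma foldl_swapLayer {β : Type*} {step : (Site d κ → β) → Gate (Site d κ) → Site d κ → β}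
    (hstep : ∀ f u v, step f (.swap u v) = f ∘ Equiv.swap u v) (f : Site d κ → β)
    (q : Site d κ) : (swapLayer d κ).foldl step f q = f (swapSite q) := by
  have hz : zOrder 0 = (-1, 1) := rfl
  have hx : xOrder 0 = (-1, 1) := rfl
  have hmem : ∀ s, s ∈ zFaces d κ ++ xFaces d κ ↔ IsFacePoint d κ s.1 := fun s => by
    rw [List.mem_append, mem_zFaces, mem_xFaces, IsFacePoint]
  have hnd : (zFaces d κ ++ xFaces d κ).Nodup := by
    refine List.nodup_append.2 ⟨Finset.nodup_toList _, Finset.nodup_toList _, ?_⟩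
    rintro s hs _ hs' rfl
    exact (mem_zFaces.1 hs).not_isXPoint (mem_xFaces.1 hs')
  rw [swapLayer, hz, hx, ← List.flatMap_append,
    foldl_swaps hstep _ hnd (fun s hs => (hmem s).1 hs)]
  split_ifs with h
  · rfl
  · simp only [hmem, not_or, not_exists, not_and] at h
    congr 1
    refine (Subtype.ext ?_ : q = swapSite q)
    simp only [swapSite, swapPoint]
    rw [if_neg fun h' => h.1 h'.1, if_neg]
    rintro ⟨h1, h2⟩
    refine h.2 ⟨q.1 + (1, -1), mem_sites.2 (.inr h2)⟩ h2 ?_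
    ext <;> simp

/-! ### Motion of vacancies -/

lemma lostAt_succ (C : Circuit (Site d κ)) (l : LossConfig (Site d κ)) (n : ℕ) (q : Site d κ) :
    lostAt C l (n + 1) q = ((C n).foldl gateLost (lostAt C l n) q || l (n + 1) q) := rfl

lemma foldl_gateLost_id {L : List (Gate (Site d κ))}
    (hL : ∀ g ∈ L, ∀ f : Site d κ → Bool, gateLost f g = f) (f : Site d κ → Bool) :
    L.foldl gateLost f = f :=
  foldl_invariant (P := fun f' => f' = f) (fun g hg f' h => by rw [hL g hg, h]) rfl

/-- The moment of the `i`-th layer of CNOTs in a round. -/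
def cnotMoment : Fin 4 → ℕ := ![1, 3, 4, 5]

lemma midSwap_prep {n : ℕ} (h : n % 7 = 0) :
    midSwap d κ n = (zFaces d κ).map Gate.prepZ ++ (xFaces d κ).map Gate.prepX := by
  simp [midSwap, h]

lemma midSwap_cnot {n : ℕ} {i : Fin 4} (h : n % 7 = cnotMoment i) :
    midSwap d κ n = cnotLayer d κ i := by
  fin_cases i <;> simp [cnotMoment] at h <;> simp [midSwap, h]

lemma midSwap_swap {n : ℕ} (h : n % 7 = 2) : midSwap d κ n = swapLayer d κ := by
  simp [midSwap, h]

lemma midSwap_meas {n : ℕ} (h : n % 7 = 6) :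
    midSwap d κ n = (zFaces d κ).map Gate.measZ ++ (xFaces d κ).map Gate.measX := by
  simp [midSwap, h]

lemma foldl_gateLost_prep {n : ℕ} (h : n % 7 = 0) (f : Site d κ → Bool) (q : Site d κ) :
    (midSwap d κ n).foldl gateLost f q = if IsFacePoint d κ q.1 then false else f q := by
  rw [midSwap_prep h]
  have hmem : ∀ g ∈ (zFaces d κ).map Gate.prepZ ++ (xFaces d κ).map Gate.prepX, ∃ s,
      IsFacePoint d κ s.1 ∧ (g = .prepZ s ∨ g = .prepX s) := by
    intro g hg
    simp only [List.mem_append, List.mem_map, mem_zFaces, mem_xFaces] at hg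
    rcases hg with ⟨s, hs, rfl⟩ | ⟨s, hs, rfl⟩
    exacts [⟨s, .inl hs, .inl rfl⟩, ⟨s, .inr hs, .inr rfl⟩]
  have hfalse : ∀ g ∈ (zFaces d κ).map Gate.prepZ ++ (xFaces d κ).map Gate.prepX,
      ∀ f : Site d κ → Bool, f q = false → gateLost f g q = false := by
    intro g hg f hf
    obtain ⟨s, -, rfl | rfl⟩ := hmem g hg <;> by_cases e : q = s <;> simp [gateLost, e, ← hf]
  split_ifs with hq
  · have : ∃ g ∈ (zFaces d κ).map Gate.prepZ ++ (xFaces d κ).map Gate.prepX,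
        ∀ f : Site d κ → Bool, gateLost f g q = false := by
      rcases hq with hq | hq
      · exact ⟨.prepZ q, by simp [mem_zFaces, hq], fun f => by simp [gateLost]⟩
      · exact ⟨.prepX q, by simp [mem_xFaces, hq], fun f => by simp [gateLost]⟩
    obtain ⟨g, hg, hg'⟩ := this
    exact foldl_of_mem (P := fun f : Site d κ → Bool => f q = false) hfalse hg hg' f
  · refine foldl_invariant (P := fun f' : Site d κ → Bool => f' q = f q) ?_ rfl
    intro g hg f' hf'
    obtain ⟨s, hs, rfl | rfl⟩ := hmem g hg <;>
    · have e : q ≠ s := by rintro rfl; exact hq hs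
      simp [gateLost, e, hf']

lemma foldl_gateLost_cnot {n : ℕ} {i : Fin 4} (h : n % 7 = cnotMoment i) (f : Site d κ → Bool) :
    (midSwap d κ n).foldl gateLost f = f := by
  rw [midSwap_cnot h]
  refine foldl_gateLost_id (fun g hg f => ?_) f
  obtain ⟨c, t, rfl⟩ := exists_cnot_of_mem_cnotLayer hg
  rfl

lemma foldl_gateLost_swap {n : ℕ} (h : n % 7 = 2) (f : Site d κ → Bool) (q : Site d κ) :
    (midSwap d κ n).foldl gateLost f q = f (swapSite q) := by
  rw [midSwap_swap h]
  exact foldl_swapLayer (fun _ _ _ => rfl) f q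

lemma foldl_gateLost_meas {n : ℕ} (h : n % 7 = 6) (f : Site d κ → Bool) :
    (midSwap d κ n).foldl gateLost f = f := by
  rw [midSwap_meas h]
  refine foldl_gateLost_id (fun g hg f => ?_) f
  simp only [List.mem_append, List.mem_map] at hg
  rcases hg with ⟨s, -, rfl⟩ | ⟨s, -, rfl⟩ <;> rfl

/-! ### Flows of `X`-type operators through the whole circuit -/

variable (d κ) in
/-- A family of supports of `X`-type operators, `V n` just before moment `n`, that is consistent
with the lossless circuit, where operators are multiplied by the stabilizers `X_q` of freshly
prepared `X` ancillas `q` and by the measured operators `X_q`. -/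
structure IsFlow (V : ℕ → ℤ × ℤ → ZMod 2) : Prop where
  -- Reloading discards the old content, so nothing may sit on a face before it; afterwards an `X`
  -- point is free, since `X` stabilizes `|+⟩`, while a `Z` point must be empty. The emptiness of
  -- faces after readout follows from `face_prep` at the next moment.
  face_prep : ∀ n, n % 7 = 0 → ∀ p, IsFacePoint d κ p → V n p = 0
  prep_z : ∀ n, n % 7 = 0 → ∀ p, IsZPoint d κ p → V (n + 1) p = 0
  prep_data : ∀ n, n % 7 = 0 → ∀ p, IsDataPoint d p → V (n + 1) p = V n p
  cnot : ∀ i n, n % 7 = cnotMoment i → ∀ p ∈ sites d κ, V (n + 1) p = layerFlow d κ i (V n) p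
  swap : ∀ n, n % 7 = 2 → ∀ p ∈ sites d κ, V (n + 1) p = V n (swapPoint d κ p)
  meas_z : ∀ n, n % 7 = 6 → ∀ p, IsZPoint d κ p → V n p = 0
  meas_data : ∀ n, n % 7 = 6 → ∀ p, IsDataPoint d p → V (n + 1) p = V n p

lemma IsFlow.add {V W : ℕ → ℤ × ℤ → ZMod 2} (hV : IsFlow d κ V) (hW : IsFlow d κ W) :
    IsFlow d κ (V + W) where
  face_prep n h p hp := by simp [hV.face_prep n h p hp, hW.face_prep n h p hp]
  prep_z n h p hp := by simp [hV.prep_z n h p hp, hW.prep_z n h p hp]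
  prep_data n h p hp := by simp [hV.prep_data n h p hp, hW.prep_data n h p hp]
  cnot i n h p hp := by
    simp only [Pi.add_apply, hV.cnot i n h p hp, hW.cnot i n h p hp, layerFlow]
    split_ifs <;> ring
  swap n h p hp := by simp [hV.swap n h p hp, hW.swap n h p hp]
  meas_z n h p hp := by simp [hV.meas_z n h p hp, hW.meas_z n h p hp]
  meas_data n h p hp := by simp [hV.meas_data n h p hp, hW.meas_data n h p hp]

variable (d κ) in
/-- The measured `X` ancillas that enter a flow. -/
def readout (V : ℕ → ℤ × ℤ → ZMod 2) (n : ℕ) (p : ℤ × ℤ) : ZMod 2 :=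
  if n % 7 = 6 ∧ IsXPoint d κ p then V n p else 0

lemma readout_add (V W : ℕ → ℤ × ℤ → ZMod 2) (n : ℕ) (p : ℤ × ℤ) :
    readout d κ (V + W) n p = readout d κ V n p + readout d κ W n p := by
  unfold readout; split_ifs <;> simp

variable (d κ) in
/-- A flow survives the losses `l`: it avoids the places of loss, the lost controls and the lost
`X` ancillas at their readout. -/
structure Survives (V : ℕ → ℤ × ℤ → ZMod 2) (l : LossConfig (Site d κ)) : Prop where
  loss : ∀ n q, l n q = true → V n q.1 = 0
  control : ∀ n q t, lostAt (midSwap d κ) l n q = true → Gate.cnot q t ∈ midSwap d κ n →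
    V n q.1 = 0
  meas : ∀ n q, lostAt (midSwap d κ) l n q = true → Measured (midSwap d κ) n q → V n q.1 = 0

lemma moment_cases (n : ℕ) :
    n % 7 = 0 ∨ n % 7 = 2 ∨ n % 7 = 6 ∨ ∃ i, n % 7 = cnotMoment i := by
  have h := Nat.mod_lt n (show 7 > 0 by norm_num)
  interval_cases n % 7
  exacts [by simp, .inr (.inr (.inr ⟨0, rfl⟩)), by simp, .inr (.inr (.inr ⟨1, rfl⟩)),
    .inr (.inr (.inr ⟨2, rfl⟩)), .inr (.inr (.inr ⟨3, rfl⟩)), by simp]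

lemma lostAt_noLoss (n : ℕ) (q : Site d κ) : lostAt (midSwap d κ) noLoss n q = false := by
  induction n generalizing q with
  | zero => rfl
  | succ n ih =>
    have ih' : lostAt (midSwap d κ) noLoss n = fun _ => false := funext ih
    rw [lostAt_succ, ih']
    rcases moment_cases n with h | h | h | ⟨i, h⟩
    · simp [foldl_gateLost_prep h, noLoss]
    · simp [foldl_gateLost_swap h, noLoss]
    · simp [foldl_gateLost_meas h, noLoss]
    · simp [foldl_gateLost_cnot h, noLoss]

lemma survives_noLoss (V : ℕ → ℤ × ℤ → ZMod 2) : Survives d κ V noLoss where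
  loss n q h := by simp [noLoss] at h
  control n q t h := by simp [lostAt_noLoss] at h
  meas n q h := by simp [lostAt_noLoss] at h

lemma measured_iff {n : ℕ} {q : Site d κ} :
    Measured (midSwap d κ) n q ↔ n % 7 = 6 ∧ IsFacePoint d κ q.1 := by
  have hc : ∀ i, Gate.measZ q ∉ cnotLayer d κ i ∧ Gate.measX q ∉ cnotLayer d κ i := by
    intro i
    constructor <;> intro h <;> obtain ⟨c, t, h⟩ := exists_cnot_of_mem_cnotLayer h <;> cases h
  rcases moment_cases n with h | h | h | ⟨i, h⟩
  · simp [Measured, midSwap_prep h, h]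
  · simp [Measured, midSwap_swap h, h, swapLayer]
  · simp [Measured, midSwap_meas h, h, mem_zFaces, mem_xFaces, IsFacePoint]
  · have : cnotMoment i ≠ 6 := by fin_cases i <;> simp [cnotMoment]
    simp [Measured, midSwap_cnot h, hc, h, this]

lemma sum_single (f : Site d κ → ZMod 2) : ∑ q, (Pi.single q (f q) : Site d κ → ZMod 2) = f := by
  funext q
  simp [Finset.sum_apply, Pi.single_apply]

lemma zmod_two_cases (a : ZMod 2) : a = 0 ∨ a = 1 := by
  revert a; decide

/-- Propagation of a surviving flow through one moment. -/
lemma Eig.moment {V : ℕ → ℤ × ℤ → ZMod 2} (hV : IsFlow d κ V)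
    (hface : ∀ n, n % 7 = 6 → ∀ p, IsFacePoint d κ p → V (n + 1) p = 0)
    {l : LossConfig (Site d κ)} (hl : Survives d κ V l) {n : ℕ} {ψ : State (Site d κ)}
    {α : ZMod 2} (m r : Site d κ → ZMod 2)
    (h : Eig ψ (mask (lostAt (midSwap d κ) l n) (V n)) α) :
    Eig ((midSwap d κ n).foldl (applyGate (lostAt (midSwap d κ) l n) m r) ψ)
      (mask (lostAt (midSwap d κ) l (n + 1)) (V (n + 1)))
      (α + ∑ q, readout d κ V n q.1 * m q) := by
  set lost := lostAt (midSwap d κ) l n with hlost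
  have hmask : mask (lostAt (midSwap d κ) l (n + 1)) (V (n + 1)) =
      mask ((midSwap d κ n).foldl gateLost lost) (V (n + 1)) := by
    funext q
    simp only [mask, lostAt_succ, ← hlost]
    -- An atom lost just before moment `n + 1` sits where the flow is zero, so removing it from the
    -- support changes nothing.
    by_cases h1 : l (n + 1) q = true
    · simp [h1, hl.loss _ _ h1]
    · simp [h1]
  rw [hmask]
  have hread : n % 7 ≠ 6 → ∑ q : Site d κ, readout d κ V n q.1 * m q = 0 := fun h6 =>
    Finset.sum_eq_zero fun q _ => by simp [readout, h6]
  rcases moment_cases n with h0 | h2 | h6 | ⟨i, hi⟩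
  · -- preparation
    have hw : ∀ q : Site d κ, IsFacePoint d κ q.1 → mask lost (V n) q = 0 := fun q hq => by
      simp [mask, hV.face_prep n h0 _ hq]
    have e1 : Eig ((midSwap d κ n).foldl (applyGate lost m r) ψ) (mask lost (V n)) α := by
      rw [midSwap_prep h0]
      refine foldl_invariant (P := fun ψ => Eig ψ (mask lost (V n)) α) ?_ h
      simp only [List.mem_append, List.mem_map, mem_zFaces, mem_xFaces]
      rintro g (⟨s, hs, rfl⟩ | ⟨s, hs, rfl⟩) ψ hψ
      exacts [hψ.prepZ _ _ _ (hw s (.inl hs)), hψ.prepX _ _ _ (hw s (.inr hs))]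
    -- Whatever the flow acquires on `X` faces here is supplied by the stabilizers of the fresh
    -- ancillas, with eigenvalue `+1`.
    have e2 : ∀ q : Site d κ, Eig ((midSwap d κ n).foldl (applyGate lost m r) ψ)
        (Pi.single q (if IsXPoint d κ q.1 then V (n + 1) q.1 else 0)) 0 := by
      intro q
      by_cases hq : IsXPoint d κ q.1
      · rcases zmod_two_cases (V (n + 1) q.1) with hv | hv
        · simpa [hv] using Eig.zero _
        · rw [if_pos hq, hv, midSwap_prep h0]
          refine foldl_of_mem (g₀ := Gate.prepX q)
            (P := fun ψ : State (Site d κ) => Eig ψ (Pi.single q 1) 0) ?_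
            (by simp [mem_xFaces, hq]) (fun ψ => Eig.prepX_self ψ _ _ _ q) ψ
          simp only [List.mem_append, List.mem_map, mem_zFaces, mem_xFaces]
          rintro g (⟨s, hs, rfl⟩ | ⟨s, hs, rfl⟩) ψ hψ
          · refine hψ.prepZ _ _ _ ?_
            have : s ≠ q := by rintro rfl; exact hs.not_isXPoint hq
            simp [this]
          · by_cases hsq : s = q
            · subst hsq; exact Eig.prepX_self ψ _ _ _ s
            · exact hψ.prepX _ _ _ (by simp [hsq])
      · simpa [hq] using Eig.zero _
    have e3 := e1.add (Eig.sum Finset.univ _ _ fun q _ => e2 q)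
    rw [sum_single (fun q : Site d κ => if IsXPoint d κ q.1 then V (n + 1) q.1 else 0)] at e3
    rw [hread (by omega)]
    convert e3 using 2
    · funext q
      simp only [mask, foldl_gateLost_prep h0, Pi.add_apply]
      rcases site_cases q with hq | hq | hq
      · have h1 : ¬ IsFacePoint d κ q.1 := hq.not_face
        have h2 : ¬ IsXPoint d κ q.1 := fun h => h1 (.inr h)
        simp [h1, h2, hV.prep_data n h0 _ hq]
      · have h1 : IsFacePoint d κ q.1 := .inl hq
        simp [h1, hq.not_isXPoint, hV.prep_z n h0 _ hq, hV.face_prep n h0 _ h1]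
      · have h1 : IsFacePoint d κ q.1 := .inr hq
        simp [h1, hq, hV.face_prep n h0 _ h1]
    · simp
  · -- shuttling
    rw [hread (by omega), add_zero]
    have e : mask ((midSwap d κ n).foldl gateLost lost) (V (n + 1)) =
        (midSwap d κ n).foldl (gateFlow lost) (mask lost (V n)) := by
      funext q
      rw [midSwap_swap h2, foldl_swapLayer (fun _ _ _ => rfl), ← midSwap_swap h2]
      simp only [mask, foldl_gateLost_swap h2, hV.swap n h2 _ q.2]
      rfl
    rw [e]
    refine h.foldl_gateFlow lost m r _ ?_
    rw [midSwap_swap h2]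
    simp only [swapLayer, List.mem_append, List.mem_flatMap, List.mem_map]
    rintro g (⟨s, -, q, -, rfl⟩ | ⟨s, -, q, -, rfl⟩) <;> exact .inr ⟨_, _, rfl⟩
  · -- readout
    have e1 : Eig ((midSwap d κ n).foldl (applyGate lost m r) ψ) (mask lost (V n)) α := by
      rw [midSwap_meas h6]
      refine foldl_invariant (P := fun ψ => Eig ψ (mask lost (V n)) α) ?_ h
      simp only [List.mem_append, List.mem_map, mem_zFaces, mem_xFaces]
      rintro g (⟨s, hs, rfl⟩ | ⟨s, hs, rfl⟩) ψ hψ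
      exacts [hψ.measZ _ _ _ (by simp [mask, hV.meas_z n h6 _ hs]), hψ.measX _ _ _ _]
    -- Multiplying by the measured operators clears the flow from the `X` faces, and their results
    -- enter the eigenvalue.
    have e2 : ∀ q : Site d κ, Eig ((midSwap d κ n).foldl (applyGate lost m r) ψ)
        (Pi.single q (readout d κ V n q.1)) (readout d κ V n q.1 * m q) := by
      intro q
      rcases zmod_two_cases (readout d κ V n q.1) with hv | hv
      · simpa [hv] using Eig.zero _
      · have hq : IsXPoint d κ q.1 := by
          by_contra hq; simp [readout, hq] at hv
        have hv' : V n q.1 = 1 := by simpa [readout, hq, h6] using hv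
        have hlq : lost q = false := by
          by_contra hlq
          have := hl.meas n q (by simpa using hlq) (measured_iff.2 ⟨h6, .inr hq⟩)
          simp [this] at hv'
        rw [hv, one_mul, midSwap_meas h6]
        refine foldl_of_mem (g₀ := Gate.measX q)
          (P := fun ψ : State (Site d κ) => Eig ψ (Pi.single q 1) (m q)) ?_
          (by simp [mem_xFaces, hq]) (fun ψ => Eig.measX_self ψ _ _ _ hlq) ψ
        simp only [List.mem_append, List.mem_map, mem_zFaces, mem_xFaces]
        rintro g (⟨s, hs, rfl⟩ | ⟨s, hs, rfl⟩) ψ hψ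
        · refine hψ.measZ _ _ _ ?_
          have : s ≠ q := by rintro rfl; exact hs.not_isXPoint hq
          simp [this]
        · exact hψ.measX _ _ _ _
    have e3 := e1.add (Eig.sum Finset.univ _ _ fun q _ => e2 q)
    rw [sum_single (fun q : Site d κ => readout d κ V n q.1)] at e3
    convert e3 using 2
    funext q
    simp only [mask, foldl_gateLost_meas h6, Pi.add_apply]
    rcases site_cases q with hq | hq | hq
    · have h1 : ¬ IsFacePoint d κ q.1 := hq.not_face
      have h2 : ¬ IsXPoint d κ q.1 := fun h => h1 (.inr h)
      simp [readout, h2, hV.meas_data n h6 _ hq]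
    · simp [readout, hq.not_isXPoint, hface n h6 _ (.inl hq), hV.meas_z n h6 _ hq]
    · rw [hface n h6 _ (.inr hq)]
      by_cases hlq : lost q = true
      · simp [readout, hlq, hl.meas n q hlq (measured_iff.2 ⟨h6, .inr hq⟩)]
      · simp [readout, hlq, hq, h6, CharTwo.add_self_eq_zero]
  · -- CNOT gates
    have hn6 : n % 7 ≠ 6 := by
      rw [hi]; fin_cases i <;> simp [cnotMoment]
    rw [hread hn6, add_zero]
    have e : mask ((midSwap d κ n).foldl gateLost lost) (V (n + 1)) =
        (midSwap d κ n).foldl (gateFlow lost) (mask lost (V n)) := by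
      rw [foldl_gateLost_cnot hi, midSwap_cnot hi, foldl_cnotLayer]
      · funext q
        simp only [mask, hV.cnot i n hi _ q.2]
      · intro c t hc hlc
        exact hl.control n c t hlc (by rwa [midSwap_cnot hi])
    rw [e]
    refine h.foldl_gateFlow lost m r _ ?_
    rw [midSwap_cnot hi]
    intro g hg
    obtain ⟨c, t, rfl⟩ := exists_cnot_of_mem_cnotLayer hg
    exact .inl ⟨c, t, (target_ne_control hg hg).symm, rfl⟩

/-- The parity of measurement results that a surviving flow determines. -/
theorem sum_readout_eq {V : ℕ → ℤ × ℤ → ZMod 2} (hV : IsFlow d κ V) {N : ℕ}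
    (hN : ∀ q : Site d κ, V N q.1 = 0) {ψ : State (Site d κ)} {β : ZMod 2}
    (hψ : Eig ψ (fun q => V 0 q.1) β) {p : PauliConfig (Site d κ)} {l : LossConfig (Site d κ)}
    (hl : Survives d κ V l) {m : Record (Site d κ)}
    (hm : m ∈ outcomes (midSwap d κ) N ψ p l) :
    β + ∑ n ∈ Finset.range N, ∑ q : Site d κ, readout d κ V n q.1 * m n q =
      ∑ n ∈ Finset.range N, ∑ q : Site d κ,
        mask (lostAt (midSwap d κ) l n) (V n) q * (p n q).2 := by
  obtain ⟨r, hr⟩ := hm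
  have hface : ∀ n, n % 7 = 6 → ∀ p, IsFacePoint d κ p → V (n + 1) p = 0 := fun n h p hp =>
    hV.face_prep (n + 1) (by omega) p hp
  have key : ∀ n, Eig (run (midSwap d κ) p l m r ψ n) (mask (lostAt (midSwap d κ) l n) (V n))
      (β + ∑ n ∈ Finset.range n, (∑ q : Site d κ, readout d κ V n q.1 * m n q +
        ∑ q : Site d κ, mask (lostAt (midSwap d κ) l n) (V n) q * (p n q).2)) := by
    intro n
    induction n with
    | zero =>
      have e : mask (lostAt (midSwap d κ) l 0) (V 0) = fun q : Site d κ => V 0 q.1 := by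
        funext q
        by_cases h1 : l 0 q = true
        · simp [mask, hl.loss _ _ h1]
        · simp [mask, lostAt, h1]
      simpa [e, run] using hψ
    | succ n ih =>
      have := Eig.moment hV hface hl (m n) (r n) (ih.applyPauli (p n))
      rw [Finset.sum_range_succ, ← add_assoc β,
        add_comm (∑ q : Site d κ, readout d κ V n q.1 * m n q), ← add_assoc]
      exact this
  have h := key N
  -- The operator has become the identity, while `hr` says that the final state is nonzero.
  have e : mask (lostAt (midSwap d κ) l N) (V N) = (0 : Site d κ → ZMod 2) := by
    funext q; simp [mask, hN]
  rw [e] at h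
  have h0 := h.eq_zero hr
  rw [Finset.sum_add_distrib, ← add_assoc] at h0
  exact CharTwo.add_eq_zero.1 h0

/-! ### Explicit flow of one syndrome bit -/

/-- `1` if `(x, y)` is the point `u`. -/
def delta (u : ℤ × ℤ) (x y : ℤ) : ZMod 2 := if u.1 = x ∧ u.2 = y then 1 else 0

/-- Support of the stabilizer `u` on data qubits. -/
def star (u : ℤ × ℤ) (x y : ℤ) : ZMod 2 :=
  delta u (x - 1) (y + 1) + delta u (x + 1) (y + 1) + delta u (x - 1) (y - 1) +
    delta u (x + 1) (y - 1)

variable (d κ) in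
/-- The function with the given restrictions to data points, `Z` points and `X` points. -/
def glue (f g h : ℤ → ℤ → ZMod 2) (p : ℤ × ℤ) : ZMod 2 :=
  if IsDataPoint d p then f p.1 p.2 else if IsZPoint d κ p then g p.1 p.2
  else if IsXPoint d κ p then h p.1 p.2 else 0

lemma glue_data {f g h : ℤ → ℤ → ZMod 2} {p : ℤ × ℤ} (hp : IsDataPoint d p) :
    glue d κ f g h p = f p.1 p.2 := by simp [glue, hp]

lemma glue_z {f g h : ℤ → ℤ → ZMod 2} {p : ℤ × ℤ} (hp : IsZPoint d κ p) :
    glue d κ f g h p = g p.1 p.2 := by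
  have : ¬ IsDataPoint d p := fun h' => h'.not_face (.inl hp)
  simp [glue, hp, this]

lemma glue_x {f g h : ℤ → ℤ → ZMod 2} {p : ℤ × ℤ} (hp : IsXPoint d κ p) :
    glue d κ f g h p = h p.1 p.2 := by
  have : ¬ IsDataPoint d p := fun h' => h'.not_face (.inr hp)
  have h2 : ¬ IsZPoint d κ p := fun h' => h'.not_isXPoint hp
  simp [glue, hp, this, h2]

/-- A data qubit feeds the `X` faces that have yet to visit it in this round. Moment `2`, between
the first CNOT and the shuttling, is special: the atom may be about to become an ancilla at its
southeast site. The congruence says that this site has `Z` colour; otherwise `x + 1 < 2 * d` decides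
whether an `X` face exists there, in which case the atom is what that face reads out. -/
def nowData (d : ℕ) (κ : ℤ) (u : ℤ × ℤ) : ℕ → ℤ → ℤ → ZMod 2
  | 0, x, y => star u x y
  | 1, x, y => star u x y
  | 2, x, y =>
    if (x + y + 2 * κ) % 4 = 0 then delta u (x + 1) (y + 1) + delta u (x - 1) (y - 1)
    else if x + 1 < 2 * d then delta u (x + 1) (y - 1) else delta u (x - 1) (y + 1)
  | 3, x, y => delta u (x - 1) (y + 1) + delta u (x + 1) (y + 1) + delta u (x - 1) (y - 1)
  | 4, x, y => delta u (x - 1) (y + 1) + delta u (x + 1) (y + 1)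
  | 5, x, y => delta u (x - 1) (y + 1)
  | _, _, _ => 0

/-- A `Z` on the target spreads to the data qubits of the remaining CNOTs. It reaches the top face
through NE and the left face through SW, each of which visits that qubit in the last layer. The
default `0` includes moment `1`, where `Z` acts trivially on `|0⟩`. -/
def nowZ (u : ℤ × ℤ) : ℕ → ℤ → ℤ → ZMod 2
  | 2, x, y => delta u x (y + 2) + delta u (x - 2) y
  | 3, x, y => delta u x (y + 2) + delta u (x - 2) y
  | 4, x, y => delta u x (y + 2)
  | _, _, _ => 0

/-- Before the shuttling the ancilla atom is bound for the northwest data site, which exists exactly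
when `y < 2 * d`; there only the face `(x - 2, y + 2)` will still visit it in this round. -/
def nowX (d : ℕ) (u : ℤ × ℤ) : ℕ → ℤ → ℤ → ZMod 2
  | 0, _, _ => 0
  | 1, x, y => if y < 2 * d then delta u (x - 2) (y + 2) else delta u x y
  | 2, x, y => if y < 2 * d then delta u (x - 2) (y + 2) else delta u x y
  | _, x, y => delta u x y

variable (d κ) in
/-- The `Z` errors just before moment `k` of a round that flip the result of the `X` ancilla `u`
in the same round. -/
def flipNow (u : ℤ × ℤ) (k : ℕ) : ℤ × ℤ → ZMod 2 :=
  glue d κ (nowData d κ u k) (nowZ u k) (nowX d u k)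

/-- After the round a data error shows on all adjacent `X` faces. The exception at moment `2` is an
atom about to become an `X` ancilla, which is read out and discarded. -/
def laterData (d : ℕ) (κ : ℤ) (u : ℤ × ℤ) : ℕ → ℤ → ℤ → ZMod 2
  | 2, x, y =>
    if (x + y + 2 * κ) % 4 = 0 then star u x y else if x + 1 < 2 * d then 0 else star u x y
  | _, x, y => star u x y

/-- Sum of `star` over the data qubits still to be visited. With three left this is the star of the
NW qubit, because the product over all four commutes with every `X` stabilizer; with two left the
right face cancels. -/
def laterZ (u : ℤ × ℤ) : ℕ → ℤ → ℤ → ZMod 2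
  | 2, x, y => delta u x (y + 2) + delta u (x - 2) y
  | 3, x, y => delta u x (y + 2) + delta u (x - 2) y
  | 4, x, y => delta u x (y + 2) + delta u x (y - 2)
  | 5, x, y => delta u (x + 2) y + delta u x (y - 2)
  | _, _, _ => 0

def laterX (d : ℕ) (u : ℤ × ℤ) : ℕ → ℤ → ℤ → ZMod 2
  | 1, x, y => if y < 2 * d then delta u x y + delta u (x - 2) (y + 2) else 0
  | 2, x, y => if y < 2 * d then delta u x y + delta u (x - 2) (y + 2) else 0
  | _, _, _ => 0

variable (d κ) in
/-- The `Z` errors just before moment `k` of a round that flip the results of the `X` ancilla `u`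
in all later rounds. -/
def flipLater (u : ℤ × ℤ) (k : ℕ) : ℤ × ℤ → ZMod 2 :=
  glue d κ (laterData d κ u k) (laterZ u k) (laterX d u k)

/-- Reduces a CNOT layer to an identity for each kind of point, so that the rest is integer
arithmetic. -/
lemma layerFlow_glue (i : Fin 4) {f g h f' g' h' : ℤ → ℤ → ZMod 2}
    (hf : ∀ x y, IsDataPoint d (x, y) → f' x y = f x y +
      if IsXPoint d κ (x - (xOrder i).1, y - (xOrder i).2) then
        h (x - (xOrder i).1) (y - (xOrder i).2) else 0)
    (hg : ∀ x y, IsZPoint d κ (x, y) → g' x y = g x y +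
      if IsDataPoint d (x + (zOrder i).1, y + (zOrder i).2) then
        f (x + (zOrder i).1) (y + (zOrder i).2) else 0)
    (hh : ∀ x y, IsXPoint d κ (x, y) → h' x y = h x y)
    {p : ℤ × ℤ} (hp : p ∈ sites d κ) :
    glue d κ f' g' h' p = layerFlow d κ i (glue d κ f g h) p := by
  obtain ⟨x, y⟩ := p
  have e1 : (x, y) + zOrder i = (x + (zOrder i).1, y + (zOrder i).2) := rfl
  have e2 : (x, y) - xOrder i = (x - (xOrder i).1, y - (xOrder i).2) := rfl
  rw [layerFlow, e1, e2]
  rcases mem_sites.1 hp with hp | hp | hp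
  · have hz : ¬ IsZPoint d κ (x, y) := fun h' => hp.not_face (.inl h')
    rw [glue_data hp, glue_data hp, hf x y hp]
    simp only [hz, hp, false_and, true_and, if_false, zero_add]
    congr 1
    split_ifs with h1
    · rw [glue_x h1]
    · rfl
  · have hd : ¬ IsDataPoint d (x, y) := fun h' => h'.not_face (.inl hp)
    rw [glue_z hp, glue_z hp, hg x y hp]
    simp only [hd, hp, false_and, true_and, if_false, add_zero]
    congr 1
    split_ifs with h1
    · rw [glue_data h1]
    · rfl
  · have hd : ¬ IsDataPoint d (x, y) := fun h' => h'.not_face (.inr hp)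
    have hz : ¬ IsZPoint d κ (x, y) := fun h' => h'.not_isXPoint hp
    rw [glue_x hp, glue_x hp, hh x y hp]
    simp [hd, hz]

lemma flipNow_cnot0 {u : ℤ × ℤ} (hu : IsXPoint d κ u) {p : ℤ × ℤ} (hp : p ∈ sites d κ) :
    flipNow d κ u 2 p = layerFlow d κ 0 (flipNow d κ u 1) p := by
  obtain ⟨a, b⟩ := u
  refine layerFlow_glue 0 ?_ ?_ ?_ hp <;> intro x y hxy
  all_goals
    simp only [nowData, nowZ, nowX, delta, star, IsDataPoint, IsZPoint, IsXPoint,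
      zOrder, xOrder, Matrix.cons_val] at *
    -- Each `split` decides whether two lattice points coincide or exist. Parity, colouring and
    -- boundary conditions exclude the inconsistent branches; in the others both sides are the same
    -- numeral.
    repeat' (split <;> try (exfalso; omega))
  all_goals rfl

lemma flipNow_cnot1 {u : ℤ × ℤ} (hu : IsXPoint d κ u) {p : ℤ × ℤ} (hp : p ∈ sites d κ) :
    flipNow d κ u 4 p = layerFlow d κ 1 (flipNow d κ u 3) p := by
  obtain ⟨a, b⟩ := u
  refine layerFlow_glue 1 ?_ ?_ ?_ hp <;> intro x y hxy
  all_goals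
    simp only [nowData, nowZ, nowX, delta, IsDataPoint, IsZPoint, IsXPoint,
      zOrder, xOrder, Matrix.cons_val] at *
    repeat' (split <;> try (exfalso; omega))
  all_goals rfl

lemma flipNow_cnot2 {u : ℤ × ℤ} (hu : IsXPoint d κ u) {p : ℤ × ℤ} (hp : p ∈ sites d κ) :
    flipNow d κ u 5 p = layerFlow d κ 2 (flipNow d κ u 4) p := by
  obtain ⟨a, b⟩ := u
  refine layerFlow_glue 2 ?_ ?_ ?_ hp <;> intro x y hxy
  all_goals
    simp only [nowData, nowZ, nowX, delta, IsDataPoint, IsZPoint, IsXPoint,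
      zOrder, xOrder, Matrix.cons_val] at *
    repeat' (split <;> try (exfalso; omega))
  all_goals rfl

lemma flipNow_cnot3 {u : ℤ × ℤ} (hu : IsXPoint d κ u) {p : ℤ × ℤ} (hp : p ∈ sites d κ) :
    flipNow d κ u 6 p = layerFlow d κ 3 (flipNow d κ u 5) p := by
  obtain ⟨a, b⟩ := u
  refine layerFlow_glue 3 ?_ ?_ ?_ hp <;> intro x y hxy
  all_goals
    simp only [nowData, nowZ, nowX, delta, IsDataPoint, IsZPoint, IsXPoint,
      zOrder, xOrder, Matrix.cons_val] at *
    repeat' (split <;> try (exfalso; omega))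
  all_goals rfl

lemma flipLater_cnot0 {u : ℤ × ℤ} (hu : IsXPoint d κ u) {p : ℤ × ℤ} (hp : p ∈ sites d κ) :
    flipLater d κ u 2 p = layerFlow d κ 0 (flipLater d κ u 1) p := by
  obtain ⟨a, b⟩ := u
  refine layerFlow_glue 0 ?_ ?_ ?_ hp <;> intro x y hxy
  all_goals
    simp only [laterData, laterZ, laterX, delta, star, IsDataPoint, IsZPoint, IsXPoint,
      zOrder, xOrder, Matrix.cons_val] at *
    repeat' (split <;> try (exfalso; omega))
  all_goals rfl

lemma flipLater_cnot1 {u : ℤ × ℤ} (hu : IsXPoint d κ u) {p : ℤ × ℤ} (hp : p ∈ sites d κ) :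
    flipLater d κ u 4 p = layerFlow d κ 1 (flipLater d κ u 3) p := by
  obtain ⟨a, b⟩ := u
  refine layerFlow_glue 1 ?_ ?_ ?_ hp <;> intro x y hxy
  all_goals
    simp only [laterData, laterZ, laterX, delta, star, IsDataPoint, IsZPoint, IsXPoint,
      zOrder, xOrder, Matrix.cons_val] at *
    repeat' (split <;> try (exfalso; omega))
  all_goals rfl

lemma flipLater_cnot2 {u : ℤ × ℤ} (hu : IsXPoint d κ u) {p : ℤ × ℤ} (hp : p ∈ sites d κ) :
    flipLater d κ u 5 p = layerFlow d κ 2 (flipLater d κ u 4) p := by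
  obtain ⟨a, b⟩ := u
  refine layerFlow_glue 2 ?_ ?_ ?_ hp <;> intro x y hxy
  all_goals
    simp only [laterData, laterZ, laterX, delta, star, IsDataPoint, IsZPoint, IsXPoint,
      zOrder, xOrder, Matrix.cons_val] at *
    repeat' (split <;> try (exfalso; omega))
  all_goals rfl

lemma flipLater_cnot3 {u : ℤ × ℤ} (hu : IsXPoint d κ u) {p : ℤ × ℤ} (hp : p ∈ sites d κ) :
    flipLater d κ u 6 p = layerFlow d κ 3 (flipLater d κ u 5) p := by
  obtain ⟨a, b⟩ := u
  refine layerFlow_glue 3 ?_ ?_ ?_ hp <;> intro x y hxy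
  all_goals
    simp only [laterData, laterZ, laterX, delta, star, IsDataPoint, IsZPoint, IsXPoint,
      zOrder, xOrder, Matrix.cons_val] at *
    repeat' (split <;> try (exfalso; omega))
  all_goals rfl

/-- The seven hypotheses separate the sites that have a partner from those that do not; `hf`, `hg'`
and `hh'` treat the latter, at the boundary. -/
lemma swapPoint_glue {f g h f' g' h' : ℤ → ℤ → ZMod 2}
    (hf : ∀ x y, IsDataPoint d (x, y) → ¬ IsFacePoint d κ (x + 1, y - 1) → f' x y = f x y)
    (hfz : ∀ x y, IsDataPoint d (x, y) → IsZPoint d κ (x + 1, y - 1) →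
      f' x y = g (x + 1) (y - 1))
    (hfx : ∀ x y, IsDataPoint d (x, y) → IsXPoint d κ (x + 1, y - 1) →
      f' x y = h (x + 1) (y - 1))
    (hg : ∀ x y, IsZPoint d κ (x, y) → IsDataPoint d (x - 1, y + 1) →
      g' x y = f (x - 1) (y + 1))
    (hg' : ∀ x y, IsZPoint d κ (x, y) → ¬ IsDataPoint d (x - 1, y + 1) → g' x y = g x y)
    (hh : ∀ x y, IsXPoint d κ (x, y) → IsDataPoint d (x - 1, y + 1) →
      h' x y = f (x - 1) (y + 1))
    (hh' : ∀ x y, IsXPoint d κ (x, y) → ¬ IsDataPoint d (x - 1, y + 1) → h' x y = h x y)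
    {p : ℤ × ℤ} (hp : p ∈ sites d κ) :
    glue d κ f' g' h' p = glue d κ f g h (swapPoint d κ p) := by
  obtain ⟨x, y⟩ := p
  have e1 : (x, y) + ((-1, 1) : ℤ × ℤ) = (x - 1, y + 1) := rfl
  have e2 : (x, y) + ((1, -1) : ℤ × ℤ) = (x + 1, y - 1) := rfl
  rw [swapPoint, e1, e2]
  rcases mem_sites.1 hp with hp | hp | hp
  · rw [if_neg fun h' => hp.not_face h'.1, glue_data hp]
    split_ifs with h1
    · rcases h1.2 with h1 | h1
      · rw [glue_z h1, hfz x y hp h1]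
      · rw [glue_x h1, hfx x y hp h1]
    · rw [glue_data hp, hf x y hp fun h2 => h1 ⟨hp, h2⟩]
  · have hd : ¬ IsDataPoint d (x, y) := fun h' => h'.not_face (.inl hp)
    rw [glue_z hp]
    split_ifs with h1 h2
    · rw [glue_data h1.2, hg x y hp h1.2]
    · exact absurd h2.1 hd
    · rw [glue_z hp, hg' x y hp fun h2 => h1 ⟨.inl hp, h2⟩]
  · have hd : ¬ IsDataPoint d (x, y) := fun h' => h'.not_face (.inr hp)
    rw [glue_x hp]
    split_ifs with h1 h2
    · rw [glue_data h1.2, hh x y hp h1.2]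
    · exact absurd h2.1 hd
    · rw [glue_x hp, hh' x y hp fun h2 => h1 ⟨.inr hp, h2⟩]

lemma flipNow_swap {u : ℤ × ℤ} (hu : IsXPoint d κ u) {p : ℤ × ℤ} (hp : p ∈ sites d κ) :
    flipNow d κ u 3 p = flipNow d κ u 2 (swapPoint d κ p) := by
  obtain ⟨a, b⟩ := u
  refine swapPoint_glue ?_ ?_ ?_ ?_ ?_ ?_ ?_ hp <;> intro x y hxy
  all_goals
    try intro hxy'
    simp only [nowData, nowZ, nowX, delta, IsDataPoint, IsZPoint, IsXPoint, IsFacePoint] at *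
    repeat' (split <;> try (exfalso; omega))
  all_goals rfl

lemma flipLater_swap {u : ℤ × ℤ} (hu : IsXPoint d κ u) {p : ℤ × ℤ} (hp : p ∈ sites d κ) :
    flipLater d κ u 3 p = flipLater d κ u 2 (swapPoint d κ p) := by
  obtain ⟨a, b⟩ := u
  refine swapPoint_glue ?_ ?_ ?_ ?_ ?_ ?_ ?_ hp <;> intro x y hxy
  all_goals
    try intro hxy'
    simp only [laterData, laterZ, laterX, IsDataPoint, IsZPoint, IsXPoint, IsFacePoint] at *
    repeat' (split <;> try first | rfl | (exfalso; omega))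
    try simp only [star, delta]
    repeat' (split <;> try (exfalso; omega))
  all_goals rfl


/-! ### Flows of syndrome bits and detectors -/

/-- The flow of the result of the `X` ancilla `u` in round `c`. -/
def syndromeFlow (d : ℕ) (κ : ℤ) (c : ℕ) (u : ℤ × ℤ) (n : ℕ) (p : ℤ × ℤ) : ZMod 2 :=
  if n / 7 < c then flipLater d κ u (n % 7) p
  else if n / 7 = c then flipNow d κ u (n % 7) p
  else 0

lemma syndromeFlow_eq {c : ℕ} {u p : ℤ × ℤ} {n c' k : ℕ} (hk : k < 7) (hn : n = 7 * c' + k) :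
    syndromeFlow d κ c u n p = if c' < c then flipLater d κ u k p
      else if c' = c then flipNow d κ u k p else 0 := by
  have h1 : n / 7 = c' := by omega
  have h2 : n % 7 = k := by omega
  rw [syndromeFlow, h1, h2]

lemma isFlow_syndromeFlow (c : ℕ) {u : ℤ × ℤ} (hu : IsXPoint d κ u) :
    IsFlow d κ (syndromeFlow d κ c u) := by
  have hcn : ∀ (k : ℕ) (i : Fin 4), k + 1 < 7 →
      (∀ p ∈ sites d κ, flipLater d κ u (k + 1) p = layerFlow d κ i (flipLater d κ u k) p) →
      (∀ p ∈ sites d κ, flipNow d κ u (k + 1) p = layerFlow d κ i (flipNow d κ u k) p) →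
      ∀ n, n % 7 = k → ∀ p ∈ sites d κ, syndromeFlow d κ c u (n + 1) p =
        layerFlow d κ i (syndromeFlow d κ c u n) p := by
    intro k i hk h1 h2 n hn p hp
    have e : syndromeFlow d κ c u n = fun p => if n / 7 < c then flipLater d κ u k p
        else if n / 7 = c then flipNow d κ u k p else 0 := by
      funext p; exact syndromeFlow_eq (by omega) (by omega)
    rw [e, syndromeFlow_eq (c' := n / 7) hk (by omega)]
    split_ifs with h3 h4
    · exact h1 p hp
    · exact h2 p hp
    · simp [layerFlow]
  constructor
  · intro n hn p hp
    rw [syndromeFlow_eq (c' := n / 7) (k := 0) (by omega) (by omega)]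
    rcases hp with hp | hp
    · simp [flipLater, flipNow, glue_z hp, laterZ, nowZ]
    · simp [flipLater, flipNow, glue_x hp, laterX, nowX]
  · intro n hn p hp
    rw [syndromeFlow_eq (c' := n / 7) (k := 1) (by omega) (by omega)]
    simp [flipLater, flipNow, glue_z hp, laterZ, nowZ]
  · intro n hn p hp
    rw [syndromeFlow_eq (c' := n / 7) (k := 1) (by omega) (by omega),
      syndromeFlow_eq (c' := n / 7) (k := 0) (by omega) (by omega)]
    simp [flipLater, flipNow, glue_data hp, laterData, nowData]
  · intro i
    fin_cases i
    · exact hcn 1 0 (by norm_num) (fun p => flipLater_cnot0 hu) (fun p => flipNow_cnot0 hu)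
    · exact hcn 3 1 (by norm_num) (fun p => flipLater_cnot1 hu) (fun p => flipNow_cnot1 hu)
    · exact hcn 4 2 (by norm_num) (fun p => flipLater_cnot2 hu) (fun p => flipNow_cnot2 hu)
    · exact hcn 5 3 (by norm_num) (fun p => flipLater_cnot3 hu) (fun p => flipNow_cnot3 hu)
  · intro n hn p hp
    rw [syndromeFlow_eq (c' := n / 7) (k := 3) (by omega) (by omega),
      syndromeFlow_eq (c' := n / 7) (k := 2) (by omega) (by omega), flipLater_swap hu hp,
      flipNow_swap hu hp]
  · intro n hn p hp
    rw [syndromeFlow_eq (c' := n / 7) (k := 6) (by omega) (by omega)]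
    simp [flipLater, flipNow, glue_z hp, laterZ, nowZ]
  · intro n hn p hp
    -- Crossing into the next round: on data points `flipLater` at `6` and both functions at `0`
    -- equal `star`, while `flipNow` at `6` is zero.
    rw [syndromeFlow_eq (c' := n / 7 + 1) (k := 0) (by omega) (by omega),
      syndromeFlow_eq (c' := n / 7) (k := 6) (by omega) (by omega)]
    simp only [flipLater, flipNow, glue_data hp, laterData, nowData]
    split_ifs <;> first | rfl | (exfalso; omega)

lemma syndromeFlow_end {c R : ℕ} (h : c < R) (u p : ℤ × ℤ) :
    syndromeFlow d κ c u (7 * R) p = 0 := by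
  rw [syndromeFlow_eq (c' := R) (k := 0) (by omega) (by omega), if_neg (by omega),
    if_neg (by omega)]

/-- Traced back to the start, a syndrome flow is the stabilizer itself, so the initial syndrome
supplies its eigenvalue. -/
lemma stabilizerSupport_eq (u q : Site d κ) (hu : IsXPoint d κ u.1) (c : ℕ) :
    syndromeFlow d κ c u.1 0 q.1 = stabilizerSupport u q := by
  rw [syndromeFlow_eq (c' := 0) (k := 0) (by omega) (by omega)]
  obtain ⟨⟨a, b⟩, ha⟩ := u
  obtain ⟨⟨x, y⟩, hq⟩ := q
  have e : ∀ p : ℤ × ℤ, p = (x, y) → flipLater d κ (a, b) 0 p = stabilizerSupport ⟨(a, b), ha⟩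
      ⟨(x, y), hq⟩ ∧ flipNow d κ (a, b) 0 p = flipLater d κ (a, b) 0 p := by
    rintro _ rfl
    rcases mem_sites.1 hq with hp | hp | hp
    · simp only [flipNow, flipLater, glue_data hp, laterData, nowData, stabilizerSupport, hp,
        true_and, star, delta, and_true]
      simp only [abs_eq (zero_le_one' ℤ)]
      repeat' (split <;> try (exfalso; omega))
      all_goals rfl
    · have hd : ¬ IsDataPoint d (x, y) := fun h' => h'.not_face (.inl hp)
      simp [flipNow, flipLater, glue_z hp, laterZ, nowZ, stabilizerSupport, hd]
    · have hd : ¬ IsDataPoint d (x, y) := fun h' => h'.not_face (.inr hp)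
      simp [flipNow, flipLater, glue_x hp, laterX, nowX, stabilizerSupport, hd]
  obtain ⟨e1, e2⟩ := e _ rfl
  rcases Nat.eq_zero_or_pos c with rfl | hc
  · simp [e2, e1]
  · simp [hc, e1]

/-- The parity of the measurement results that enter a flow. -/
noncomputable def readoutSum (N : ℕ) (V : ℕ → ℤ × ℤ → ZMod 2) (m : Record (Site d κ)) : ZMod 2 :=
  ∑ n ∈ Finset.range N, ∑ q : Site d κ, readout d κ V n q.1 * m n q

lemma readoutSum_add (N : ℕ) (V W : ℕ → ℤ × ℤ → ZMod 2) (m : Record (Site d κ)) :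
    readoutSum N (V + W) m = readoutSum N V m + readoutSum N W m := by
  simp only [readoutSum, readout_add, add_mul, Finset.sum_add_distrib]

lemma readout_syndromeFlow {c : ℕ} {u : ℤ × ℤ} (hu : IsXPoint d κ u) (n : ℕ) (p : ℤ × ℤ) :
    readout d κ (syndromeFlow d κ c u) n p = if n = 7 * c + 6 ∧ p = u then 1 else 0 := by
  unfold readout
  by_cases h6 : n % 7 = 6
  · by_cases hp : IsXPoint d κ p
    · rw [if_pos ⟨h6, hp⟩, syndromeFlow_eq (c' := n / 7) (k := 6) (by omega) (by omega)]
      have e1 : flipLater d κ u 6 p = 0 := glue_x hp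
      have e2 : flipNow d κ u 6 p = if u = p then 1 else 0 := by
        rw [flipNow, glue_x hp]
        simp [nowX, delta, Prod.ext_iff]
      rw [e1, e2]
      by_cases h : n / 7 = c
      · have : n = 7 * c + 6 := by omega
        simp [this, eq_comm,
          show (7 * c + 6) / 7 = c by omega]
      · have : n ≠ 7 * c + 6 := by omega
        simp [h, this]
    · have : p ≠ u := by rintro rfl; exact hp hu
      simp [hp, this]
  · have : n ≠ 7 * c + 6 := by omega
    simp [h6, this]

lemma readoutSum_syndromeFlow {c R : ℕ} (hc : c < R) {u : Site d κ} (hu : IsXPoint d κ u.1)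
    (m : Record (Site d κ)) :
    readoutSum (7 * R) (syndromeFlow d κ c u.1) m = m (readoutMoment c) u := by
  simp only [readoutSum, readout_syndromeFlow hu]
  rw [Finset.sum_eq_single (7 * c + 6), Finset.sum_eq_single u]
  · simp [readoutMoment]
  · intro q _ hq
    have : q.1 ≠ u.1 := fun e => hq (Subtype.ext e)
    simp [this]
  · simp
  · intro n _ hn
    simp [hn]
  · intro h
    rw [Finset.mem_range] at h
    omega

lemma eig_syndromeFlow {ψ : State (Site d κ)} {g : Site d κ → ZMod 2} (hψ : HasXSyndrome ψ g)
    {u : Site d κ} (hu : IsXPoint d κ u.1) (c : ℕ) :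
    Eig ψ (fun q => syndromeFlow d κ c u.1 0 q.1) (g u) := by
  have : (fun q : Site d κ => syndromeFlow d κ c u.1 0 q.1) = stabilizerSupport u :=
    funext fun q => stabilizerSupport_eq u q hu c
  rw [this]
  exact hψ u hu

/-- The flow of the detector `(c, u)`. -/
def detectorFlow (d : ℕ) (κ : ℤ) (u : ℤ × ℤ) : ℕ → ℕ → ℤ × ℤ → ZMod 2
  | 0 => syndromeFlow d κ 0 u
  | c + 1 => syndromeFlow d κ (c + 1) u + syndromeFlow d κ c u

/-- For `c + 1` the two flows start from the same stabilizer. The value is left as a sum, which is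
zero, to match `Eig.add`. -/
def detectorSign (g : Site d κ → ZMod 2) (u : Site d κ) : ℕ → ZMod 2
  | 0 => g u
  | _ + 1 => g u + g u

lemma isFlow_detectorFlow {u : ℤ × ℤ} (hu : IsXPoint d κ u) (c : ℕ) :
    IsFlow d κ (detectorFlow d κ u c) := by
  cases c with
  | zero => exact isFlow_syndromeFlow 0 hu
  | succ c => exact (isFlow_syndromeFlow _ hu).add (isFlow_syndromeFlow _ hu)

lemma detectorFlow_end {c R : ℕ} (h : c < R) (u p : ℤ × ℤ) :
    detectorFlow d κ u c (7 * R) p = 0 := by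
  cases c with
  | zero => exact syndromeFlow_end h u p
  | succ c =>
    simp [detectorFlow, syndromeFlow_end h, syndromeFlow_end (show c < R by omega)]

lemma eig_detectorFlow {ψ : State (Site d κ)} {g : Site d κ → ZMod 2} (hψ : HasXSyndrome ψ g)
    {u : Site d κ} (hu : IsXPoint d κ u.1) (c : ℕ) :
    Eig ψ (fun q => detectorFlow d κ u.1 c 0 q.1) (detectorSign g u c) := by
  cases c with
  | zero => exact eig_syndromeFlow hψ hu 0
  | succ c => exact (eig_syndromeFlow hψ hu _).add (eig_syndromeFlow hψ hu _)

lemma detector_eq {c R : ℕ} (hc : c < R) {u : Site d κ} (hu : IsXPoint d κ u.1)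
    (g : Site d κ → ZMod 2) (m : Record (Site d κ)) :
    detector g m c u =
      detectorSign g u c + readoutSum (7 * R) (detectorFlow d κ u.1 c) m := by
  cases c with
  | zero => rw [detectorFlow, readoutSum_syndromeFlow hc hu, detector, detectorSign, add_comm]
  | succ c =>
    rw [detectorFlow, readoutSum_add, readoutSum_syndromeFlow hc hu,
      readoutSum_syndromeFlow (show c < R by omega) hu, detector, detectorSign,
      CharTwo.add_self_eq_zero, zero_add]

/-- In the lossless circuit the detectors are determined by the `Z` errors. -/
theorem detector_noLoss {R : ℕ} {ψ : State (Site d κ)} {g : Site d κ → ZMod 2}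
    (hψ : HasXSyndrome ψ g) {p : PauliConfig (Site d κ)} {m : Record (Site d κ)}
    (hm : m ∈ outcomes (midSwap d κ) (7 * R) ψ p noLoss) {c : ℕ} (hc : c < R) {u : Site d κ}
    (hu : IsXPoint d κ u.1) :
    detector g m c u = ∑ n ∈ Finset.range (7 * R), ∑ q : Site d κ,
      detectorFlow d κ u.1 c n q.1 * (p n q).2 := by
  rw [detector_eq hc hu, readoutSum, sum_readout_eq (isFlow_detectorFlow hu c)
    (fun q => detectorFlow_end hc _ _) (eig_detectorFlow hψ hu c) (survives_noLoss _) hm]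
  simp [mask, lostAt_noLoss]

/-! ### Parities that a loss cannot change -/

/-- A space-time location of the lost atom that is not in its Pauli envelope and where it is not
the control of a CNOT. -/
structure Harmless (n₀ : ℕ) (q₀ : Site d κ) (n : ℕ) (q : Site d κ) : Prop where
  ne : n ≠ n₀
  role : ¬ RoleChange (midSwap d κ) (singleLoss n₀ q₀) n
  control : ∀ t, Gate.cnot q t ∉ midSwap d κ n
  meas : ¬ Measured (midSwap d κ) n q

/-- A flow that avoids the envelope of a lost atom determines a parity of results. -/
theorem readoutSum_of_mem_lossOutcomes {V : ℕ → ℤ × ℤ → ZMod 2} (hV : IsFlow d κ V) {N : ℕ}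
    (hN : ∀ q : Site d κ, V N q.1 = 0) {ψ : State (Site d κ)} {β : ZMod 2}
    (hψ : Eig ψ (fun q => V 0 q.1) β) {n₀ : ℕ} {q₀ : Site d κ}
    (hl : ∀ n q, lostAt (midSwap d κ) (singleLoss n₀ q₀) n q = true →
      V n q.1 = 0 ∨ Harmless n₀ q₀ n q)
    {m : Record (Site d κ)} (hm : m ∈ lossOutcomes (midSwap d κ) N ψ n₀ q₀) :
    β + readoutSum N V m = 0 := by
  rcases hm with hm | hm
  · have hs : Survives d κ V (singleLoss n₀ q₀) := by
      constructor
      · intro n q h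
        have hlost : lostAt (midSwap d κ) (singleLoss n₀ q₀) n q = true := by
          cases n with
          | zero => exact h
          | succ n => rw [lostAt_succ, h, Bool.or_true]
        have hn : n = n₀ ∧ q = q₀ := by simpa [singleLoss] using h
        exact (hl n q hlost).resolve_right fun h' => h'.ne hn.1
      · intro n q t h ht
        exact (hl n q h).resolve_right fun h' => h'.control t ht
      · intro n q h hmeas
        exact (hl n q h).resolve_right fun h' => h'.meas hmeas
    rw [readoutSum, sum_readout_eq hV hN hψ hs hm]
    simp [noPauli]
  -- For the envelope the circuit is lossless, and each of its errors sits at a place that is not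
  -- harmless, hence off the flow.
  · simp only [Set.mem_iUnion] at hm
    obtain ⟨e, he, hm⟩ := hm
    rw [readoutSum, sum_readout_eq hV hN hψ (survives_noLoss V) hm]
    refine Finset.sum_eq_zero fun n _ => Finset.sum_eq_zero fun q _ => ?_
    by_cases h0 : e n q = 0
    · simp [h0]
    · obtain ⟨h1, h2⟩ := he n q h0
      have : V n q.1 = 0 := by
        refine (hl n q h1).resolve_right fun h' => ?_
        rcases h2 with h2 | h2 | h2
        exacts [h'.ne h2, h'.role h2, h'.meas h2]
      simp [mask, this]

variable (d κ) in
/-- A `Z` error at `p` just before moment `k` of a round affects only `X` ancillas in `S`, and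
those in later rounds all equally. -/
def AffectsOnly (S : Sym2 (ℤ × ℤ)) (k : ℕ) (p : ℤ × ℤ) : Prop :=
  (∀ u, IsXPoint d κ u → u ∉ S → flipNow d κ u k p = 0 ∧ flipLater d κ u k p = 0) ∧
    ∀ u u', IsXPoint d κ u → IsXPoint d κ u' → u ∈ S → u' ∈ S →
      flipLater d κ u k p = flipLater d κ u' k p

/-- Telescoping: the projection of a pattern involves only the last result and the initial syndrome.
-/
lemma sum_detector (g : Site d κ → ZMod 2) (m : Record (Site d κ)) (R : ℕ) (u : Site d κ) :
    ∑ c ∈ Finset.range (R + 1), detector g m c u = m (readoutMoment R) u + g u := by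
  induction R with
  | zero => simp [detector]
  | succ R ih =>
    rw [Finset.sum_range_succ, ih, detector]
    linear_combination CharTwo.add_self_eq_zero (m (readoutMoment R) u)

theorem triggersAtMost_of_affectsOnly {R : ℕ} {S : Sym2 (ℤ × ℤ)} {n₀ : ℕ} {q₀ : Site d κ}
    (hl : ∀ n q, lostAt (midSwap d κ) (singleLoss n₀ q₀) n q = true →
      (n < 7 * R ∧ AffectsOnly d κ S (n % 7) q.1) ∨ Harmless n₀ q₀ n q)
    {ψ : State (Site d κ)} {g : Site d κ → ZMod 2} (hψ : HasXSyndrome ψ g)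
    {m : Record (Site d κ)} (hm : m ∈ lossOutcomes (midSwap d κ) (7 * (R + 1)) ψ n₀ q₀) :
    TriggersAtMost (R + 1) (detector g m) S := by
  have hout : ∀ c < R + 1, ∀ u : Site d κ, IsXPoint d κ u.1 → u.1 ∉ S → detector g m c u = 0 := by
    intro c hc u hu hS
    rw [detector_eq hc hu]
    refine readoutSum_of_mem_lossOutcomes (isFlow_detectorFlow hu c)
      (fun q => detectorFlow_end hc _ _) (eig_detectorFlow hψ hu c) (fun n q h => ?_) hm
    refine (hl n q h).imp_left fun h' => ?_
    obtain ⟨h1, h2⟩ := h'.2.1 u.1 hu hS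
    have h3 : ∀ c, syndromeFlow d κ c u.1 n q.1 = 0 := fun c => by simp [syndromeFlow, h1, h2]
    cases c <;> simp [detectorFlow, h3]
  have hin : ∀ u u' : Site d κ, IsXPoint d κ u.1 → IsXPoint d κ u'.1 → u.1 ∈ S → u'.1 ∈ S →
      ∑ c ∈ Finset.range (R + 1), detector g m c u =
        ∑ c ∈ Finset.range (R + 1), detector g m c u' := by
    intro u u' hu hu' hS hS'
    -- There are `R + 1` rounds, so round `R` is the last one. Places with `n < 7 * R` precede it,
    -- only `flipLater` enters, and the two flows cancel there.
    have h := readoutSum_of_mem_lossOutcomes (N := 7 * (R + 1))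
      (V := syndromeFlow d κ R u.1 + syndromeFlow d κ R u'.1)
      ((isFlow_syndromeFlow R hu).add (isFlow_syndromeFlow R hu'))
      (fun q => by simp [syndromeFlow_end])
      ((eig_syndromeFlow hψ hu R).add (eig_syndromeFlow hψ hu' R)) (fun n q h => ?_) hm
    · rw [readoutSum_add, readoutSum_syndromeFlow (by omega) hu,
        readoutSum_syndromeFlow (by omega) hu'] at h
      rw [sum_detector, sum_detector, ← CharTwo.add_eq_zero]
      linear_combination h
    · refine (hl n q h).imp_left fun h' => ?_
      have h1 : n / 7 < R := by omega
      simp [syndromeFlow, h1, h'.2.2 _ _ hu hu' hS hS', CharTwo.add_self_eq_zero]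
  refine ⟨fun c hc u hu hD => ?_, ?_⟩
  · by_contra hS
    exact hD (hout c hc u hu hS)
  · by_cases h0 : ∃ u : Site d κ, IsXPoint d κ u.1 ∧
      ∑ c ∈ Finset.range (R + 1), detector g m c u ≠ 0
    · obtain ⟨u₁, hu₁, h₁⟩ := h0
      -- One face with odd projection lies in `S` and forces every face of `S` to be odd.
      have hS₁ : u₁.1 ∈ S := by
        by_contra hS
        exact h₁ (Finset.sum_eq_zero fun c hc => hout c (Finset.mem_range.1 hc) u₁ hu₁ hS)
      refine .inr fun u hu => ⟨fun h => ?_, fun hS => ?_⟩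
      · by_contra hS
        exact h (Finset.sum_eq_zero fun c hc => hout c (Finset.mem_range.1 hc) u hu hS)
      · rwa [hin u u₁ hu hu₁ hS hS₁]
    · push Not at h0
      exact .inl h0

/-! ### The history of a lost atom -/

/-- The site before moment `n` of the atom that is at `q` after it. -/
def previousSite (n : ℕ) (q : Site d κ) : Site d κ := if n % 7 = 2 then swapSite q else q

lemma foldl_gateLost_iff (n : ℕ) (f : Site d κ → Bool) (q : Site d κ) :
    (midSwap d κ n).foldl gateLost f q = true ↔
      f (previousSite n q) = true ∧ ¬ (n % 7 = 0 ∧ IsFacePoint d κ q.1) := by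
  rcases moment_cases n with h | h | h | ⟨i, h⟩
  · rw [foldl_gateLost_prep h]
    by_cases hq : IsFacePoint d κ q.1 <;> simp [previousSite, h, hq]
  · simp [foldl_gateLost_swap h, previousSite, h]
  · simp [foldl_gateLost_meas h, previousSite, h]
  · have h0 : n % 7 ≠ 0 ∧ n % 7 ≠ 2 := by rw [h]; fin_cases i <;> simp [cnotMoment]
    simp [foldl_gateLost_cnot h, previousSite, h0]

lemma previousSite_injective (n : ℕ) :
    Function.Injective (previousSite n : Site d κ → Site d κ) := by
  intro q q' h
  unfold previousSite at h
  split_ifs at h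
  · rw [← swapSite_swapSite q, h, swapSite_swapSite]
  · exact h

section Lost

variable {n₀ : ℕ} {q₀ : Site d κ}

lemma lostAt_singleLoss_succ {n : ℕ} {q : Site d κ} :
    lostAt (midSwap d κ) (singleLoss n₀ q₀) (n + 1) q = true ↔
      (lostAt (midSwap d κ) (singleLoss n₀ q₀) n (previousSite n q) = true ∧
        ¬ (n % 7 = 0 ∧ IsFacePoint d κ q.1)) ∨ (n + 1 = n₀ ∧ q = q₀) := by
  rw [lostAt_succ, Bool.or_eq_true, foldl_gateLost_iff]
  simp [singleLoss]

lemma le_of_lostAt {n : ℕ} {q : Site d κ}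
    (h : lostAt (midSwap d κ) (singleLoss n₀ q₀) n q = true) : n₀ ≤ n := by
  induction n generalizing q with
  | zero =>
    have : 0 = n₀ ∧ q = q₀ := by simpa [lostAt, singleLoss] using h
    omega
  | succ n ih =>
    rcases lostAt_singleLoss_succ.1 h with h | h
    · have := ih h.1
      omega
    · omega

lemma eq_of_lostAt {n : ℕ} {q q' : Site d κ}
    (h : lostAt (midSwap d κ) (singleLoss n₀ q₀) n q = true)
    (h' : lostAt (midSwap d κ) (singleLoss n₀ q₀) n q' = true) : q = q' := by
  induction n generalizing q q' with
  | zero =>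
    have h1 : 0 = n₀ ∧ q = q₀ := by simpa [lostAt, singleLoss] using h
    have h2 : 0 = n₀ ∧ q' = q₀ := by simpa [lostAt, singleLoss] using h'
    rw [h1.2, h2.2]
  | succ n ih =>
    rcases lostAt_singleLoss_succ.1 h with h | h <;> rcases lostAt_singleLoss_succ.1 h' with h' | h'
    · exact previousSite_injective n (ih h.1 h'.1)
    · have := le_of_lostAt h.1
      omega
    · have := le_of_lostAt h'.1
      omega
    · rw [h.2, h'.2]

lemma lostAt_previousSite {n : ℕ} {q : Site d κ}
    (h : lostAt (midSwap d κ) (singleLoss n₀ q₀) (n + 1) q = true) (hn : n₀ ≤ n) :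
    lostAt (midSwap d κ) (singleLoss n₀ q₀) n (previousSite n q) = true ∧
      ¬ (n % 7 = 0 ∧ IsFacePoint d κ q.1) := by
  rcases lostAt_singleLoss_succ.1 h with h | h
  · exact h
  · omega

/-- The places of an atom that is reported missing at the face `s` in round `c`: it was loaded
at `s` in the preceding round, if a data atom is exchanged with `s` at all. -/
theorem location_of_lost {s : Site d κ} (hs : IsFacePoint d κ s.1) {c : ℕ}
    (hlost : lostAt (midSwap d κ) (singleLoss n₀ q₀) (7 * c + 6) s = true) {n : ℕ} {q : Site d κ}
    (h : lostAt (midSwap d κ) (singleLoss n₀ q₀) n q = true) :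
    (n = 7 * c + 7 ∧ q = s) ∨ (7 * c + 3 ≤ n ∧ n ≤ 7 * c + 6 ∧ q = s) ∨
      (7 * c + 1 ≤ n ∧ n ≤ 7 * c + 2 ∧ q = swapSite s) ∨
      (¬ IsFacePoint d κ (swapSite s).1 ∧
        ((7 * c ≤ n + 4 ∧ n ≤ 7 * c ∧ q = swapSite s) ∨
          (7 * c ≤ n + 6 ∧ n + 5 ≤ 7 * c ∧ q = s))) := by
  have hn₀ := le_of_lostAt hlost
  have hn := le_of_lostAt h
  have stay : ∀ {n : ℕ} {q : Site d κ}, n % 7 ≠ 2 →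
      lostAt (midSwap d κ) (singleLoss n₀ q₀) (n + 1) q = true → n₀ ≤ n →
      lostAt (midSwap d κ) (singleLoss n₀ q₀) n q = true ∧
        ¬ (n % 7 = 0 ∧ IsFacePoint d κ q.1) := by
    intro n q h2 h hn
    simpa [previousSite, h2] using lostAt_previousSite h hn
  have move : ∀ {n : ℕ} {q : Site d κ}, n % 7 = 2 →
      lostAt (midSwap d κ) (singleLoss n₀ q₀) (n + 1) q = true → n₀ ≤ n →
      lostAt (midSwap d κ) (singleLoss n₀ q₀) n (swapSite q) = true := by
    intro n q h2 h hn
    simpa [previousSite, h2] using (lostAt_previousSite h hn).1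
  by_cases hlate : 7 * c + 7 ≤ n
  · have h7 : ∀ q, lostAt (midSwap d κ) (singleLoss n₀ q₀) (7 * c + 7) q = true → q = s :=
      fun q hq => eq_of_lostAt (stay (n := 7 * c + 6) (by omega) hq hn₀).1 hlost
    -- Moment `7 * c + 7` reloads `s`, so the vacancy disappears for good.
    have h8 : ∀ j q, lostAt (midSwap d κ) (singleLoss n₀ q₀) (7 * c + 8 + j) q ≠ true := by
      intro j
      induction j with
      | zero =>
        intro q hq
        have := stay (n := 7 * c + 7) (by omega) hq (by omega)
        rw [h7 q this.1] at this
        exact this.2 ⟨by omega, hs⟩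
      | succ j ih =>
        intro q hq
        exact ih _ (lostAt_previousSite (n := 7 * c + 8 + j) hq (by omega)).1
    rcases Nat.eq_or_lt_of_le hlate with e | hlt
    · subst e
      exact .inl ⟨rfl, h7 q h⟩
    · obtain ⟨j, rfl⟩ := Nat.exists_eq_add_of_le (show 7 * c + 8 ≤ n by omega)
      exact absurd h (h8 j q)
  · have a5 := fun h : n₀ ≤ 7 * c + 5 => (stay (n := 7 * c + 5) (by omega) hlost h).1
    have a4 := fun h : n₀ ≤ 7 * c + 4 => (stay (n := 7 * c + 4) (by omega) (a5 (by omega)) h).1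
    have a3 := fun h : n₀ ≤ 7 * c + 3 => (stay (n := 7 * c + 3) (by omega) (a4 (by omega)) h).1
    have a2 := fun h : n₀ ≤ 7 * c + 2 => move (n := 7 * c + 2) (by omega) (a3 (by omega)) h
    have a1 := fun h : n₀ ≤ 7 * c + 1 => (stay (n := 7 * c + 1) (by omega) (a2 (by omega)) h).1
    have a0 := fun h : n₀ ≤ 7 * c => stay (n := 7 * c) (by omega) (a1 (by omega)) h
    by_cases e6 : n = 7 * c + 6
    · subst e6; exact .inr (.inl ⟨by omega, by omega, eq_of_lostAt h hlost⟩)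
    by_cases e5 : n = 7 * c + 5
    · subst e5; exact .inr (.inl ⟨by omega, by omega, eq_of_lostAt h (a5 hn)⟩)
    by_cases e4 : n = 7 * c + 4
    · subst e4; exact .inr (.inl ⟨by omega, by omega, eq_of_lostAt h (a4 hn)⟩)
    by_cases e3 : n = 7 * c + 3
    · subst e3; exact .inr (.inl ⟨by omega, by omega, eq_of_lostAt h (a3 hn)⟩)
    by_cases e2 : n = 7 * c + 2
    · subst e2; exact .inr (.inr (.inl ⟨by omega, by omega, eq_of_lostAt h (a2 hn)⟩))
    by_cases e1 : n = 7 * c + 1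
    · subst e1; exact .inr (.inr (.inl ⟨by omega, by omega, eq_of_lostAt h (a1 hn)⟩))
    have hn0 : n₀ ≤ 7 * c := by omega
    -- If `swapSite s` is a face, its atom was loaded at moment `7 * c` and could not have been
    -- missing before.
    refine .inr (.inr (.inr ⟨fun hf => (a0 hn0).2 ⟨by omega, hf⟩, ?_⟩))
    by_cases e0 : n = 7 * c
    · subst e0; exact .inl ⟨by omega, by omega, eq_of_lostAt h (a0 hn).1⟩
    obtain ⟨c, rfl⟩ : ∃ c', c = c' + 1 := ⟨c - 1, by omega⟩
    have b6 := fun h : n₀ ≤ 7 * c + 6 => (stay (n := 7 * c + 6) (by omega) (a0 hn0).1 h).1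
    have b5 := fun h : n₀ ≤ 7 * c + 5 => (stay (n := 7 * c + 5) (by omega) (b6 (by omega)) h).1
    have b4 := fun h : n₀ ≤ 7 * c + 4 => (stay (n := 7 * c + 4) (by omega) (b5 (by omega)) h).1
    have b3 := fun h : n₀ ≤ 7 * c + 3 => (stay (n := 7 * c + 3) (by omega) (b4 (by omega)) h).1
    have b2 := fun h : n₀ ≤ 7 * c + 2 => move (n := 7 * c + 2) (by omega) (b3 (by omega)) h
    rw [swapSite_swapSite] at b2
    have b1 := fun h : n₀ ≤ 7 * c + 1 => (stay (n := 7 * c + 1) (by omega) (b2 (by omega)) h).1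
    -- Here `c` has been shifted to the preceding round, whose moment `7 * c` loaded this atom at
    -- `s`; an earlier vacancy would have been refilled.
    have b0 : ¬ n₀ ≤ 7 * c := fun h => (stay (n := 7 * c) (by omega) (b1 (by omega)) h).2 ⟨by omega, hs⟩
    by_cases e6 : n = 7 * c + 6
    · subst e6; exact .inl ⟨by omega, by omega, eq_of_lostAt h (b6 hn)⟩
    by_cases e5 : n = 7 * c + 5
    · subst e5; exact .inl ⟨by omega, by omega, eq_of_lostAt h (b5 hn)⟩
    by_cases e4 : n = 7 * c + 4
    · subst e4; exact .inl ⟨by omega, by omega, eq_of_lostAt h (b4 hn)⟩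
    by_cases e3 : n = 7 * c + 3
    · subst e3; exact .inl ⟨by omega, by omega, eq_of_lostAt h (b3 hn)⟩
    by_cases e2 : n = 7 * c + 2
    · subst e2; exact .inr ⟨by omega, by omega, eq_of_lostAt h (b2 hn)⟩
    by_cases e1 : n = 7 * c + 1
    · subst e1; exact .inr ⟨by omega, by omega, eq_of_lostAt h (b1 hn)⟩
    omega

lemma cnot_mem_midSwap {n : ℕ} {q t : Site d κ} (h : Gate.cnot q t ∈ midSwap d κ n) :
    ∃ i, n % 7 = cnotMoment i ∧ Gate.cnot q t ∈ cnotLayer d κ i := by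
  rcases moment_cases n with h' | h' | h' | ⟨i, h'⟩
  · simp [midSwap_prep h'] at h
  · simp [midSwap_swap h', swapLayer] at h
  · simp [midSwap_meas h'] at h
  · exact ⟨i, h', by rwa [midSwap_cnot h'] at h⟩

lemma not_control_of_isZPoint {n : ℕ} {s t : Site d κ} (hs : IsZPoint d κ s.1) :
    Gate.cnot s t ∉ midSwap d κ n := by
  intro h
  obtain ⟨i, -, h⟩ := cnot_mem_midSwap h
  rcases mem_cnotLayer.1 h with ⟨h1, h2⟩ | ⟨h1, -⟩
  · have h3 : IsDataPoint d s.1 := by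
      rw [h2]; exact isDataPoint_add_zOrder h1 (h2 ▸ s.2)
    exact h3.not_face (.inl hs)
  · exact hs.not_isXPoint h1

lemma harmless_of_prep {n : ℕ} {q : Site d κ} (hn : n ≠ n₀) (h0 : n % 7 = 0) :
    Harmless n₀ q₀ n q where
  ne := hn
  role := by
    rintro ⟨n', -, ⟨-, q, t, -, h⟩ | ⟨-, q, t, -, h⟩, -⟩ <;>
      simp [midSwap_prep h0] at h
  control t h := by simp [midSwap_prep h0] at h
  meas h := by
    have := (measured_iff.1 h).1
    omega

/-- After the shuttling, the second CNOT of a `Z` ancilla is the last to which its lost atom can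
come in a new role. -/
lemma harmless_z {s : Site d κ} (hs : IsZPoint d κ s.1) {c : ℕ}
    (hlost : lostAt (midSwap d κ) (singleLoss n₀ q₀) (7 * c + 6) s = true) {n : ℕ} (hn : n ≠ n₀)
    (h : n = 7 * c + 4 ∨ n = 7 * c + 5) : Harmless n₀ q₀ n s where
  ne := hn
  control t := not_control_of_isZPoint hs
  meas h := by
    have := (measured_iff.1 h).1
    omega
  role := by
    have loc := fun {n q} h => location_of_lost (n := n) (q := q) (.inl hs) hlost h
    have hcontrol : ∀ k, 7 * c + 3 ≤ k → k ≤ 7 * c + 6 →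
        ¬ LostIsControl (midSwap d κ) (singleLoss n₀ q₀) k := by
      rintro k hk hk' ⟨q, t, hq, ht⟩
      have : q = s := by
        rcases loc hq with h | h | h | h
        · exact h.2
        · exact h.2.2
        · omega
        · omega
      rw [this] at ht
      exact not_control_of_isZPoint hs ht
    rintro ⟨n', hn', ⟨h1, h2⟩ | ⟨h1, h2⟩, hk⟩
    -- A change from control to target at the third or fourth CNOT would require an earlier control
    -- with no CNOT in between. The second CNOT, at `7 * c + 3`, rules this out.
    · by_cases hle : 7 * c + 3 ≤ n'
      · exact hcontrol n' hle (by omega) h1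
      obtain ⟨q, t, hq, ht⟩ := h1
      have hqs : q ≠ s := fun e => not_control_of_isZPoint hs (e ▸ ht)
      have hsw : swapSite s ≠ s := by
        intro e
        rcases loc hq with h | h | h | ⟨-, h | h⟩
        · exact hqs h.2
        · exact hqs h.2.2
        · exact hqs (h.2.2.trans e)
        · exact hqs (h.2.2.trans e)
        · exact hqs h.2.2
      have hd : IsDataPoint d (s.1 + (-1, 1)) := by
        by_contra hd
        refine hsw (Subtype.ext ?_)
        have h' : ¬ IsDataPoint d s.1 := fun h' => h'.not_face (.inl hs)
        simp [swapSite, swapPoint, hd, h']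
      -- A `Z` face with a northwest data qubit also has a southwest one, so its second CNOT is
      -- really performed.
      have hsw' : s.1 + zOrder 1 ∈ sites d κ := by
        refine mem_sites.2 (.inl ?_)
        simp only [zOrder, Matrix.cons_val, IsDataPoint, IsZPoint, Prod.fst_add,
          Prod.snd_add] at hd hs ⊢
        omega
      have hstay : lostAt (midSwap d κ) (singleLoss n₀ q₀) (7 * c + 3) s = true := by
        have hn₀ := le_of_lostAt hq
        have step : ∀ n, n % 7 ≠ 2 → n₀ ≤ n →
            lostAt (midSwap d κ) (singleLoss n₀ q₀) (n + 1) s = true →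
            lostAt (midSwap d κ) (singleLoss n₀ q₀) n s = true := fun n h2 hn h => by
          simpa [previousSite, h2] using (lostAt_previousSite h hn).1
        exact step _ (by omega) (by omega) (step _ (by omega) (by omega)
          (step _ (by omega) (by omega) hlost))
      refine (hk (7 * c + 3) (by omega) (by omega)).2 ⟨s, ⟨_, hsw'⟩, hstay, ?_⟩
      rw [midSwap_cnot (i := 1) (by simp only [cnotMoment, Matrix.cons_val]; omega), mem_cnotLayer]
      exact .inl ⟨hs, rfl⟩
    · exact hcontrol n (by omega) (by omega) h2

end Lost

/-! ### Faces affected at each place of the lost atom -/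

lemma AffectsOnly.of {S : Sym2 (ℤ × ℤ)} {k : ℕ} {p : ℤ × ℤ} (a : ZMod 2)
    (h : ∀ u, IsXPoint d κ u → (u ∉ S → flipNow d κ u k p = 0) ∧
      flipLater d κ u k p = if u ∈ S then a else 0) : AffectsOnly d κ S k p := by
  refine ⟨fun u hu hS => ⟨(h u hu).1 hS, ?_⟩, fun u u' hu hu' hS hS' => ?_⟩
  · rw [(h u hu).2, if_neg hS]
  · rw [(h u hu).2, (h u' hu').2, if_pos hS, if_pos hS']

lemma affectsOnly_z_readout {p : ℤ × ℤ} (hp : IsZPoint d κ p) (S : Sym2 (ℤ × ℤ)) :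
    AffectsOnly d κ S 6 p := by
  refine .of 0 fun u _ => ?_
  rw [flipNow, flipLater, glue_z hp, glue_z hp]
  simp [nowZ, laterZ]

/-- At moments `1` and `2` the atom is a fresh ancilla, or has no data partner; at `3` it has just
been shuttled to the face, and SW, NE, SE remain, equivalent to NW alone. -/
lemma affectsOnly_z_S₁ {x y : ℤ} (hs : IsZPoint d κ (x, y)) {k : ℕ} (hk : k = 1 ∨ k = 2 ∨ k = 3) :
    AffectsOnly d κ (S₁ x y) k (x, y) := by
  refine .of (if k = 1 then 0 else 1) fun ⟨a, b⟩ hu => ?_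
  rw [flipNow, flipLater, glue_z hs, glue_z hs]
  simp only [S₁, Sym2.mem_iff, Prod.mk.injEq, IsZPoint, IsXPoint] at *
  rcases hk with rfl | rfl | rfl <;> refine ⟨fun hS => ?_, ?_⟩ <;> simp only [nowZ, laterZ, delta] <;>
    repeat' (split <;> try (exfalso; omega))
  all_goals first | rfl | trivial

lemma affectsOnly_z_S₂ {x y : ℤ} (hs : IsZPoint d κ (x, y))  :
    AffectsOnly d κ (S₂ x y) 4 (x, y) := by
  refine .of (1) fun ⟨a, b⟩ hu => ?_
  rw [flipNow, flipLater, glue_z hs, glue_z hs]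
  simp only [S₂, Sym2.mem_iff, Prod.mk.injEq, IsZPoint, IsXPoint] at *
  refine ⟨fun hS => ?_, ?_⟩ <;> simp only [nowZ, laterZ, delta] <;>
    repeat' (split <;> try (exfalso; omega))
  all_goals rfl

lemma affectsOnly_z_S₃ {x y : ℤ} (hs : IsZPoint d κ (x, y))  :
    AffectsOnly d κ (S₃ x y) 5 (x, y) := by
  refine .of (1) fun ⟨a, b⟩ hu => ?_
  rw [flipNow, flipLater, glue_z hs, glue_z hs]
  simp only [S₃, Sym2.mem_iff, Prod.mk.injEq, IsZPoint, IsXPoint] at *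
  refine ⟨fun hS => ?_, ?_⟩ <;> simp only [nowZ, laterZ, delta] <;>
    repeat' (split <;> try (exfalso; omega))
  all_goals rfl

/-- The northwest data qubit of a `Z` face is adjacent to exactly the two possible `X` positions of
`S₁`, the left and the top one. -/
lemma affectsOnly_data_S₁ {x y : ℤ} (hs : IsZPoint d κ (x, y))
    (hq : IsDataPoint d (x - 1, y + 1)) {k : ℕ} (hk : k < 7) :
    AffectsOnly d κ (S₁ x y) k (x - 1, y + 1) := by
  refine .of (1) fun ⟨a, b⟩ hu => ?_
  rw [flipNow, flipLater, glue_data hq, glue_data hq]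
  simp only [S₁, Sym2.mem_iff, Prod.mk.injEq, IsDataPoint, IsZPoint, IsXPoint] at *
  have hstar : star (a, b) (x - 1) (y + 1) =
      if a = x - 2 ∧ b = y ∨ a = x ∧ b = y + 2 then 1 else 0 := by
    simp only [star, delta]
    repeat' (split <;> try (exfalso; omega))
    all_goals rfl
  interval_cases k <;> refine ⟨fun hS => ?_, ?_⟩ <;> simp only [nowData, laterData, hstar, delta] <;>
    repeat' (split <;> try (exfalso; omega))
  all_goals rfl

/-- After the shuttling an error at the face flips only its own readout; before it, the atom is on
its way to the data qubit shared by the faces of `S₄`. -/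
lemma affectsOnly_x_S₄ {x y : ℤ} (hs : IsXPoint d κ (x, y - 2)) {k : ℕ}
    (hk : 1 ≤ k) (hk' : k < 7) :
    AffectsOnly d κ (S₄ x y) k (x, y - 2) := by
  refine .of (if k ≤ 2 ∧ y - 2 < 2 * d then 1 else 0) fun ⟨a, b⟩ hu => ?_
  rw [flipNow, flipLater, glue_x hs, glue_x hs]
  simp only [S₄, Sym2.mem_iff, Prod.mk.injEq, IsXPoint] at *
  interval_cases k <;> refine ⟨fun hS => ?_, ?_⟩ <;> simp only [nowX, laterX, delta] <;>
    repeat' (split <;> try (exfalso; omega))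
  all_goals rfl

lemma affectsOnly_data_S₄ {x y : ℤ} (hs : IsXPoint d κ (x, y - 2))
    (hq : IsDataPoint d (x - 1, y - 1)) {k : ℕ} (hk : k < 7) :
    AffectsOnly d κ (S₄ x y) k (x - 1, y - 1) := by
  refine .of (if k = 2 then 0 else 1) fun ⟨a, b⟩ hu => ?_
  rw [flipNow, flipLater, glue_data hq, glue_data hq]
  simp only [S₄, Sym2.mem_iff, Prod.mk.injEq, IsDataPoint, IsXPoint] at *
  have hstar : star (a, b) (x - 1) (y - 1) =
      if a = x - 2 ∧ b = y ∨ a = x ∧ b = y - 2 then 1 else 0 := by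
    simp only [star, delta]
    repeat' (split <;> try (exfalso; omega))
    all_goals rfl
  interval_cases k <;> refine ⟨fun hS => ?_, ?_⟩ <;> simp only [nowData, laterData, hstar, delta] <;>
    repeat' (split <;> try (exfalso; omega))
  all_goals first | rfl | trivial

lemma swapSite_face (s : Site d κ) (hs : IsFacePoint d κ s.1) :
    (IsDataPoint d (s.1 + (-1, 1)) ∧ (swapSite s).1 = s.1 + (-1, 1)) ∨ swapSite s = s := by
  by_cases hd : IsDataPoint d (s.1 + (-1, 1))
  · exact .inl ⟨hd, by simp [swapSite, swapPoint, hs, hd]⟩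
  · refine .inr (Subtype.ext ?_)
    have h' : ¬ IsDataPoint d s.1 := fun h' => h'.not_face hs
    simp [swapSite, swapPoint, hd, h']

/-- The pair is fixed by the loss time: up to the second CNOT it is `S₁`, just before the third
`S₂`, and afterwards `S₃`. -/
theorem triggersAtMost_of_lossDetected_z {R : ℕ} {x y : ℤ} {s : Site d κ} (hs : IsZFace s)
    (hsxy : s.1 = (x, y)) {ψ : State (Site d κ)} {g : Site d κ → ZMod 2}
    (hψ : HasXSyndrome ψ g) {n₀ : ℕ} {q₀ : Site d κ} {c : ℕ} (hc : c < R)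
    (hlost : LossDetected (midSwap d κ) (singleLoss n₀ q₀) (readoutMoment c) s)
    {m : Record (Site d κ)} (hm : m ∈ lossOutcomes (midSwap d κ) (7 * (R + 1)) ψ n₀ q₀) :
    ∃ S ∈ [S₁ x y, S₂ x y, S₃ x y], TriggersAtMost (R + 1) (detector g m) S := by
  have hz : IsZPoint d κ (x, y) := hsxy ▸ hs
  have hl : lostAt (midSwap d κ) (singleLoss n₀ q₀) (7 * c + 6) s = true := hlost.2
  have hn₀ := le_of_lostAt hl
  have loc := fun {n q} h => location_of_lost (n := n) (q := q) (.inl hs) hl h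
  have late : ∀ {S n q}, lostAt (midSwap d κ) (singleLoss n₀ q₀) n q = true → 7 * c + 6 ≤ n →
      (n < 7 * R ∧ AffectsOnly d κ S (n % 7) q.1) ∨ Harmless n₀ q₀ n q := by
    intro S n q h hn
    rcases loc h with ⟨rfl, rfl⟩ | ⟨h1, h2, rfl⟩ | h1 | h1
    · exact .inr (harmless_of_prep (by omega) (by omega))
    · have : n % 7 = 6 := by omega
      rw [this]
      exact .inl ⟨by omega, affectsOnly_z_readout hs S⟩
    · omega
    · omega
  by_cases h3 : n₀ ≤ 7 * c + 3
  · refine ⟨S₁ x y, by simp, triggersAtMost_of_affectsOnly (fun n q h => ?_) hψ hm⟩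
    by_cases hn : 7 * c + 6 ≤ n
    · exact late h hn
    have hnR : n < 7 * R := by omega
    have atS : ∀ k, n % 7 = k → (k = 1 ∨ k = 2 ∨ k = 3) → q = s →
        AffectsOnly d κ (S₁ x y) (n % 7) q.1 := by
      rintro k rfl hk rfl
      rw [hsxy]
      exact affectsOnly_z_S₁ hz hk
    have atNW : (swapSite s).1 = s.1 + (-1, 1) → IsDataPoint d (s.1 + (-1, 1)) →
        q = swapSite s → AffectsOnly d κ (S₁ x y) (n % 7) q.1 := by
      rintro h1 h2 rfl
      rw [h1, hsxy]
      exact affectsOnly_data_S₁ hz (by rw [hsxy] at h2; exact h2) (Nat.mod_lt _ (by norm_num))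
    rcases loc h with h1 | ⟨h1, h2, h4⟩ | ⟨h1, h2, h4⟩ | ⟨h1, ⟨h2, h4, h5⟩ | ⟨h2, h4, h5⟩⟩
    · omega
    · by_cases e : n = 7 * c + 3
      · exact .inl ⟨hnR, atS 3 (by omega) (by simp) h4⟩
      -- Moments `7 * c + 4` and `7 * c + 5` would belong to other pairs, but for a loss this early
      -- they are harmless.
      · rw [h4]
        exact .inr (harmless_z hs hl (by omega) (by omega))
    · refine .inl ⟨hnR, ?_⟩
      rcases swapSite_face s (.inl hs) with ⟨h5, h6⟩ | h5
      · exact atNW h6 h5 h4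
      · exact atS _ rfl (by omega) (h4.trans h5)
    · refine .inl ⟨hnR, ?_⟩
      rcases swapSite_face s (.inl hs) with ⟨h6, h7⟩ | h6
      · exact atNW h7 h6 h5
      · exact absurd (.inl hs) (h6 ▸ h1)
    · exact .inl ⟨hnR, atS _ rfl (by omega) h5⟩
  · have hsite : ∀ {n q}, lostAt (midSwap d κ) (singleLoss n₀ q₀) n q = true →
        n₀ ≤ n ∧ (n < 7 * c + 6 → q = s) := by
      intro n q h
      have hn := le_of_lostAt h
      refine ⟨hn, fun hn' => ?_⟩
      rcases loc h with h1 | h1 | h1 | h1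
      exacts [h1.2, h1.2.2, by omega, by omega]
    by_cases h4 : n₀ = 7 * c + 4
    · refine ⟨S₂ x y, by simp, triggersAtMost_of_affectsOnly (fun n q h => ?_) hψ hm⟩
      by_cases hn : 7 * c + 6 ≤ n
      · exact late h hn
      obtain ⟨h1, h2⟩ := hsite h
      rw [h2 (by omega)]
      by_cases h5 : n = 7 * c + 4
      · rw [hsxy, show n % 7 = 4 by omega]
        exact .inl ⟨by omega, affectsOnly_z_S₂ hz⟩
      · exact .inr (harmless_z hs hl (by omega) (by omega))
    -- This includes a loss just before the readout, which affects no `X` detector, so any pair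
    -- would do.
    · refine ⟨S₃ x y, by simp, triggersAtMost_of_affectsOnly (fun n q h => ?_) hψ hm⟩
      by_cases hn : 7 * c + 6 ≤ n
      · exact late h hn
      obtain ⟨h1, h2⟩ := hsite h
      rw [h2 (by omega), hsxy, show n % 7 = 5 by omega]
      exact .inl ⟨by omega, affectsOnly_z_S₃ hz⟩

/-- Every place of the atom before its reload affects only `S₄`, so role changes need no discussion.
-/
theorem triggersAtMost_of_lossDetected_x {R : ℕ} {x y : ℤ} {s : Site d κ} (hs : IsXFace s)
    (hsxy : s.1 = (x, y - 2)) {ψ : State (Site d κ)} {g : Site d κ → ZMod 2}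
    (hψ : HasXSyndrome ψ g) {n₀ : ℕ} {q₀ : Site d κ} {c : ℕ} (hc : c < R)
    (hlost : LossDetected (midSwap d κ) (singleLoss n₀ q₀) (readoutMoment c) s)
    {m : Record (Site d κ)} (hm : m ∈ lossOutcomes (midSwap d κ) (7 * (R + 1)) ψ n₀ q₀) :
    TriggersAtMost (R + 1) (detector g m) (S₄ x y) := by
  have hx : IsXPoint d κ (x, y - 2) := hsxy ▸ hs
  have hl : lostAt (midSwap d κ) (singleLoss n₀ q₀) (7 * c + 6) s = true := hlost.2
  have hn₀ := le_of_lostAt hl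
  refine triggersAtMost_of_affectsOnly (fun n q h => ?_) hψ hm
  have atS : 1 ≤ n % 7 → q = s → AffectsOnly d κ (S₄ x y) (n % 7) q.1 := by
    rintro hk rfl
    rw [hsxy]
    exact affectsOnly_x_S₄ hx hk (Nat.mod_lt _ (by norm_num))
  have atNW : (swapSite s).1 = s.1 + (-1, 1) → IsDataPoint d (s.1 + (-1, 1)) →
      q = swapSite s → AffectsOnly d κ (S₄ x y) (n % 7) q.1 := by
    rintro h1 h2 rfl
    have e : s.1 + (-1, 1) = (x - 1, y - 1) := by
      rw [hsxy]; ext <;> simp <;> ring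
    rw [h1, e]
    exact affectsOnly_data_S₄ hx (e ▸ h2) (Nat.mod_lt _ (by norm_num))
  rcases location_of_lost (.inr hs) hl h with
    h1 | ⟨h1, h2, h4⟩ | ⟨h1, h2, h4⟩ | ⟨h1, ⟨h2, h4, h5⟩ | ⟨h2, h4, h5⟩⟩
  · exact .inr (harmless_of_prep (by omega) (by omega))
  · exact .inl ⟨by omega, atS (by omega) h4⟩
  · refine .inl ⟨by omega, ?_⟩
    rcases swapSite_face s (.inr hs) with ⟨h5, h6⟩ | h5
    · exact atNW h6 h5 h4
    · exact atS (by omega) (h4.trans h5)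
  · refine .inl ⟨by omega, ?_⟩
    rcases swapSite_face s (.inr hs) with ⟨h6, h7⟩ | h6
    · exact atNW h7 h6 h5
    · exact absurd (.inr hs) (h6 ▸ h1)
  · exact .inl ⟨by omega, atS (by omega) h5⟩

/-! ### Edges of the matching graph -/

/-- The detectors triggered by a single `Z` error in round `0`. -/
lemma pauliTriggers_z {R : ℕ} (hR : 0 < R) {k : ℕ} (hk : k < 7) (q : Site d κ)
    {F : Set (ℕ × Site d κ)}
    (hF : ∀ c u, IsXPoint d κ u.1 → ((c, u) ∈ F ↔ (c = 0 ∧ flipNow d κ u.1 k q.1 ≠ 0) ∨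
      (c = 1 ∧ flipNow d κ u.1 k q.1 + flipLater d κ u.1 k q.1 ≠ 0))) :
    PauliTriggers R k q (0, 1) F := by
  intro ψ g hψ m hm c hc u hu
  have hu' : IsXPoint d κ u.1 := hu
  rw [detector_noLoss hψ hm hc hu, hF c u hu, Finset.sum_eq_single k, Finset.sum_eq_single q]
  · have hs : ∀ c, syndromeFlow d κ c u.1 k q.1 =
        if 0 < c then flipLater d κ u.1 k q.1 else flipNow d κ u.1 k q.1 := by
      intro c
      rw [syndromeFlow_eq (c' := 0) (k := k) hk (by omega)]
      split_ifs <;> first | rfl | omega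
    simp only [singlePauli, and_self, if_true, mul_one]
    match c with
    | 0 => simp [detectorFlow, hs]
    | 1 => simp [detectorFlow, hs, add_comm]
    | c + 2 => simp [detectorFlow, hs, CharTwo.add_self_eq_zero]
  · intro q' _ hq'
    simp [singlePauli, hq']
  · simp
  · intro n _ hn
    simp [singlePauli, hn]
  · intro h
    rw [Finset.mem_range] at h
    omega

/-- The two `X` ancillas of a data qubit are joined. -/
lemma adj_of_star {R : ℕ} (hR : 2 ≤ R) {u v q : Site d κ} (huv : u ≠ v) (hu : IsXFace u)
    (hv : IsXFace v) (hq : IsDataPoint d q.1)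
    (h : ∀ w : Site d κ, IsXPoint d κ w.1 → (star w.1 q.1.1 q.1.2 ≠ 0 ↔ w = u ∨ w = v)) :
    (matchingGraph d κ R).Adj u v := by
  -- After the last CNOT of round `0` a data error is first seen in round `1`, which exists since `2
  -- ≤ R`; both detectors lie in that round.
  refine ⟨huv, hu, hv, 6, by omega, q, (0, 1), 1, by omega, 1, by omega,
    pauliTriggers_z (by omega) (by norm_num) q fun c w hw => ?_⟩
  have e1 : flipNow d κ w.1 6 q.1 = 0 := glue_data hq
  have e2 : flipLater d κ w.1 6 q.1 = star w.1 q.1.1 q.1.2 := glue_data hq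
  rw [e1, e2, zero_add, h w hw]
  simp only [Set.mem_insert_iff, Set.mem_singleton_iff, Prod.mk.injEq]
  tauto

lemma adj_of_delta {R : ℕ} (hR : 2 ≤ R) {x y : ℤ} {s u v : Site d κ} (hs : IsZFace s)
    (hsxy : s.1 = (x, y)) (hu : IsXFace u) (hv : IsXFace v) (hux : u.1 = (x, y + 2))
    (hvx : v.1 = (x, y - 2)) : (matchingGraph d κ R).Adj u v := by
  have huv : u ≠ v := by
    rintro rfl
    have := congrArg Prod.snd (hux.symm.trans hvx)
    simp only at this
    omega
  -- A hook error: before the third CNOT the `Z` spreads to NE and SE. The top face sees it already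
  -- in round `0`, the bottom face only in round `1`, and the right face is hit twice.
  refine ⟨huv, hu, hv, 4, by omega, s, (0, 1), 0, by omega, 1, by omega,
    pauliTriggers_z (by omega) (by norm_num) s fun c w hw => ?_⟩
  have e1 : flipNow d κ w.1 4 s.1 = delta w.1 s.1.1 (s.1.2 + 2) := glue_z hs
  have e2 : flipLater d κ w.1 4 s.1 = delta w.1 s.1.1 (s.1.2 + 2) + delta w.1 s.1.1 (s.1.2 - 2) :=
    glue_z hs
  rw [e1, e2, ← add_assoc, CharTwo.add_self_eq_zero, zero_add]
  simp only [Set.mem_insert_iff, Set.mem_singleton_iff, Subtype.ext_iff, delta,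
    hsxy, hux, hvx, Prod.ext_iff]
  simp

lemma adj_diagonal {R : ℕ} (hR : 2 ≤ R) {a b : ℤ} {u v : Site d κ} (hu : IsXFace u)
    (hv : IsXFace v) (hux : u.1 = (a, b)) (hvx : v.1 = (a + 2, b + 2)) :
    (matchingGraph d κ R).Adj u v := by
  have hu' : IsXPoint d κ (a, b) := hux ▸ hu
  have hv' : IsXPoint d κ (a + 2, b + 2) := hvx ▸ hv
  have hq : IsDataPoint d (a + 1, b + 1) := by
    simp only [IsXPoint, IsDataPoint] at *; omega
  have huv : u ≠ v := by
    rintro rfl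
    have := congrArg Prod.fst (hux.symm.trans hvx)
    simp only at this
    omega
  refine adj_of_star (q := ⟨_, mem_sites.2 (.inl hq)⟩) hR huv hu hv hq fun w hw => ?_
  obtain ⟨⟨x, y⟩, hxy⟩ := w
  simp only [Subtype.ext_iff, hux, hvx, Prod.mk.injEq, star, delta, IsXPoint] at *
  repeat' (split <;> try (exfalso; omega))
  all_goals (simp; omega)

lemma adj_antidiagonal {R : ℕ} (hR : 2 ≤ R) {a b : ℤ} {u v : Site d κ} (hu : IsXFace u)
    (hv : IsXFace v) (hux : u.1 = (a - 2, b)) (hvx : v.1 = (a, b - 2)) :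
    (matchingGraph d κ R).Adj u v := by
  have hu' : IsXPoint d κ (a - 2, b) := hux ▸ hu
  have hv' : IsXPoint d κ (a, b - 2) := hvx ▸ hv
  have hq : IsDataPoint d (a - 1, b - 1) := by
    simp only [IsXPoint, IsDataPoint] at *; omega
  have huv : u ≠ v := by
    rintro rfl
    have := congrArg Prod.fst (hux.symm.trans hvx)
    simp only at this
    omega
  refine adj_of_star (q := ⟨_, mem_sites.2 (.inl hq)⟩) hR huv hu hv hq fun w hw => ?_
  obtain ⟨⟨x, y⟩, hxy⟩ := w
  simp only [Subtype.ext_iff, hux, hvx, Prod.mk.injEq, star, delta, IsXPoint] at *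
  repeat' (split <;> try (exfalso; omega))
  all_goals (simp; omega)

lemma isMatchingEdge_of {R : ℕ} {a b : ℤ × ℤ}
    (h : ∀ u v : Site d κ, IsXFace u → IsXFace v → u.1 = a → v.1 = b →
      (matchingGraph d κ R).Adj u v) : IsMatchingEdge d κ R s(a, b) := by
  intro u v hu hv e
  rcases Sym2.eq_iff.1 e with ⟨h1, h2⟩ | ⟨h1, h2⟩
  · exact h u v hu hv h1 h2
  · exact (h v u hv hu h2 h1).symm

lemma adj_S₁ {R : ℕ} (hR : 2 ≤ R) {x y : ℤ} {u v : Site d κ} (hu : IsXFace u) (hv : IsXFace v)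
    (hux : u.1 = (x - 2, y)) (hvx : v.1 = (x, y + 2)) : (matchingGraph d κ R).Adj u v :=
  adj_diagonal hR hu hv hux (by rw [hvx, sub_add_cancel])

lemma adj_S₃ {R : ℕ} (hR : 2 ≤ R) {x y : ℤ} {u v : Site d κ} (hu : IsXFace u) (hv : IsXFace v)
    (hux : u.1 = (x, y - 2)) (hvx : v.1 = (x + 2, y)) : (matchingGraph d κ R).Adj u v :=
  adj_diagonal hR hu hv hux (by rw [hvx, sub_add_cancel])

lemma exists_path_of_z {R : ℕ} (hR : 2 ≤ R) {x y : ℤ} {s : Site d κ} (hs : IsZFace s)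
    (hsxy : s.1 = (x, y)) {left top bottom right : Site d κ} (hl : left.1 = (x - 2, y))
    (ht : top.1 = (x, y + 2)) (hb : bottom.1 = (x, y - 2)) (hr : right.1 = (x + 2, y)) :
    ∃ w : (matchingGraph d κ R).Walk left right,
      w.IsPath ∧ w.edges = [s(left, top), s(top, bottom), s(bottom, right)] := by
  have hz : IsZPoint d κ (x, y) := hsxy ▸ hs
  -- The four points are assumed only to be sites; parity and colouring force them to be `X` faces.
  have hX : ∀ w : Site d κ, (w.1.1 % 2 = 0 ∧ (w.1.1 + w.1.2 + 2 * κ) % 4 = 2) → IsXFace w := by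
    rintro w ⟨h1, h2⟩
    rcases site_cases w with h | h | h
    · simp only [IsDataPoint] at h; omega
    · simp only [IsZPoint] at h; omega
    · exact h
  simp only [IsZPoint] at hz
  have hlX : IsXFace left := hX _ (by simp only [hl]; omega)
  have htX : IsXFace top := hX _ (by simp only [ht]; omega)
  have hbX : IsXFace bottom := hX _ (by simp only [hb]; omega)
  have hrX : IsXFace right := hX _ (by simp only [hr]; omega)
  refine ⟨.cons (adj_S₁ hR hlX htX hl ht) (.cons (adj_of_delta hR hs hsxy htX hbX ht hb)
    (.cons (adj_S₃ hR hbX hrX hb hr) .nil)), ?_, rfl⟩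
  rw [SimpleGraph.Walk.isPath_def]
  simp only [SimpleGraph.Walk.support_cons, SimpleGraph.Walk.support_nil, List.nodup_cons,
    List.mem_cons, List.not_mem_nil, or_false, not_false_eq_true, List.nodup_nil, and_true,
    Subtype.ext_iff, hl, ht, hb, hr, Prod.mk.injEq]
  omega

end SurfaceCode

end MidSwap

theorem mainTheorem8 (d : ℕ) (κ : ℤ) (R : ℕ) (hR : 2 ≤ R) (x y : ℤ) :
    -- loss of a `Z` ancilla at `(x, y)`
    (∀ s : MidSwap.Site d κ, MidSwap.IsZFace s → s.1 = (x, y) →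
      (∀ (ψ : MidSwap.State (MidSwap.Site d κ)) (g : MidSwap.Site d κ → ZMod 2),
        MidSwap.HasXSyndrome ψ g →
        ∀ (n₀ : ℕ) (q₀ : MidSwap.Site d κ) (c : ℕ), c + 1 < R →
        MidSwap.LossDetected (MidSwap.midSwap d κ) (MidSwap.singleLoss n₀ q₀)
          (MidSwap.readoutMoment c) s →
        ∀ m ∈ MidSwap.lossOutcomes (MidSwap.midSwap d κ) (7 * R) ψ n₀ q₀,
          ∃ S ∈ [MidSwap.S₁ x y, MidSwap.S₂ x y, MidSwap.S₃ x y],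
            MidSwap.TriggersAtMost R (MidSwap.detector g m) S) ∧
      (∀ S ∈ [MidSwap.S₁ x y, MidSwap.S₂ x y, MidSwap.S₃ x y],
        MidSwap.IsMatchingEdge d κ R S) ∧
      (∀ left top bottom right : MidSwap.Site d κ,
        left.1 = (x - 2, y) → top.1 = (x, y + 2) →
        bottom.1 = (x, y - 2) → right.1 = (x + 2, y) →
        ∃ w : (MidSwap.matchingGraph d κ R).Walk left right,
          w.IsPath ∧ w.edges = [s(left, top), s(top, bottom), s(bottom, right)])) ∧
    -- loss of an `X` ancilla at `(x, y - 2)`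
    (∀ s : MidSwap.Site d κ, MidSwap.IsXFace s → s.1 = (x, y - 2) →
      (∀ (ψ : MidSwap.State (MidSwap.Site d κ)) (g : MidSwap.Site d κ → ZMod 2),
        MidSwap.HasXSyndrome ψ g →
        ∀ (n₀ : ℕ) (q₀ : MidSwap.Site d κ) (c : ℕ), c + 1 < R →
        MidSwap.LossDetected (MidSwap.midSwap d κ) (MidSwap.singleLoss n₀ q₀)
          (MidSwap.readoutMoment c) s →
        ∀ m ∈ MidSwap.lossOutcomes (MidSwap.midSwap d κ) (7 * R) ψ n₀ q₀,
          MidSwap.TriggersAtMost R (MidSwap.detector g m) (MidSwap.S₄ x y)) ∧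
      MidSwap.IsMatchingEdge d κ R (MidSwap.S₄ x y)) := by
  -- With `R + 1` rounds, the last one has index `R`, and a detection before it means `c < R`.
  obtain ⟨R, rfl⟩ : ∃ R', R = R' + 1 := ⟨R - 1, by omega⟩
  refine ⟨fun s hs hsxy => ⟨?_, ?_, ?_⟩, fun s hs hsxy => ⟨?_, ?_⟩⟩
  · intro ψ g hψ n₀ q₀ c hc hlost m hm
    exact MidSwap.triggersAtMost_of_lossDetected_z hs hsxy hψ (by omega) hlost hm
  · simp only [List.mem_cons, List.not_mem_nil, or_false]
    rintro S (rfl | rfl | rfl)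
    · exact MidSwap.isMatchingEdge_of fun u v => MidSwap.adj_S₁ hR
    · exact MidSwap.isMatchingEdge_of fun u v => MidSwap.adj_of_delta hR hs hsxy
    · exact MidSwap.isMatchingEdge_of fun u v => MidSwap.adj_S₃ hR
  · intro left top bottom right hl ht hb hr
    exact MidSwap.exists_path_of_z hR hs hsxy hl ht hb hr
  · intro ψ g hψ n₀ q₀ c hc hlost m hm
    exact MidSwap.triggersAtMost_of_lossDetected_x hs hsxy hψ (by omega) hlost hm
  · exact MidSwap.isMatchingEdge_of fun u v => MidSwap.adj_antidiagonal hR
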